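/- **Setting.** Let $(\mathcal E,\mathcal F)$ be a resistance form on a set $X$: $\mathcal F$ is a linear space of real functions on $X$ containing the constants, $\mathcal E$ is a nonnegative quadratic form on $\mathcal F$ (with associated symmetric bilinear form $\mathcal E(u,v)$) with $\mathcal E(u,u)=0$ iff $u$ is constant, $\mathcal F$ modulo constants is a Hilbert space under $\mathcal E$, $\mathcal F$ separates points, $R(x,y):=\bigl(\inf\{\mathcal E(u,u): u\in\mathcal F,\ u(x)=1,\ u(y)=0\}\bigr)^{-1}<\infty$ for $x\ne y$ (and $R(x,x):=0$), and for $u\in\mathcal F$ the function $\hat u=\max\{0,\min\{1,u\}\}$ is in $\mathcal F$ with $\mathcal E(\hat u,\hat u)\le\mathcal E(u,u)$. Then $R$ is a metric on $X$; assume that it is complete. The form is *local* if $\mathcal E(u,v)=0$ for all $u,v\in\mathcal F$ with $\inf\{R(x,y): u(x)\neq0,\ v(y)\ne0\}>0$ (where $\inf\emptyset=\infty$). Let $T$ be a countable set and $\pi:T\to T$ a map such that $F_\pi=\{w:\pi^n(w)=w\text{ for some }n\ge1\}$ has at most one element and any $w,v\in T$ satisfy $\pi^n(w)=\pi^m(v)$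 for some $n,m\ge0$; let $\phi\in T$, with $\phi\in F_\pi$ if $F_\pi\neq\emptyset$. Put $b(w,v)=\min\{n\ge0:\pi^n(w)=\pi^m(v)\text{ for some }m\ge0\}$, $[w]=b(w,\phi)-b(\phi,w)$, $T_n=\{w:[w]=n\}$ for $n\in\mathbb Z$, and $\acute\pi^{-k}(w)=\{v\in T_{[w]+k}:\pi^k(v)=w\}$ for $k\ge 0$. Let $K:T\to\mathfrak P(X)$, $w\mapsto K_w$, be a *partition* of $(X,R)$: $X$ has no isolated points; each $K_w$ is compact with at least two points; $\bigcup_{w\in T_0}K_w=X$ and $\bigcup_{v\in\acute\pi^{-1}(w)}K_v=K_w$ for all $w$; and $\bigcap_{k\ge0}K_{w_k}$ is a single point whenever $w_k\in T_k$ and $\pi(w_{k+1})=w_k$ for all $k\ge0$. Let $E_n=\{(w,v)\in T_n\times T_n: K_w\cap K_v\ne\emptyset,\ w\neq v\}$, let $l_n$ be the graph distance of $(T_n,E_n)$ (possibly $\infty$), and let $\Delta_m(x,y)=\sup\{n: x\in K_w,\ y\in K_v,\ l_n(w,v)\le m\text{ for some }w,v\in T_n\}$. Assume that $K$ satisfies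 the *basic framework* with scale $\zeta\in(0,1)$ and $M_*\in\mathbb Z_{\ge0}$, that is: - $\sup_w\#\acute\pi^{-1}(w)<\infty$ and $\sup_w\#\{v:(w,v)\in E_{[w]}\}<\infty$; - $\mathrm{int}(K_w)\cap\mathrm{int}(K_v)=\emptyset$ if $[w]=[v]$ and $w\ne v$; - there are $c,C>0$ with $c\,\zeta^{[w]}\le\mathrm{diam}(K_w)\le C\zeta^{[w]}$ for all $w\in T$; - there is $\xi>0$ such that each $K_w$ contains a ball $B_R(x_w,\xi\zeta^{[w]})$ with $x_w\in K_w$; - there are $c,C>0$ with $c\,\zeta^{\Delta_{M_*}(x,y)}\le R(x,y)\le C\zeta^{\Delta_{M_*}(x,y)}$ for all $x,y\in X$ (with $\zeta^\infty=0$). For $w\in T$ and $k\ge0$ let $\mathcal C_{w,k}=\{v\in T_{[w]+k}: l_{[w]}(w,\pi^k(v))>M_*\}$ and $$\mathcal E_{2,k,w}=\inf\Bigl\{\tfrac12\sum_{(u,v)\in E_{[w]+k}}|f(u)-f(v)|^2 : f:T_{[w]+k}\to\mathbb R,\ f|_{\acute\pi^{-k}(w)}\equiv1,\ f|_{\mathcal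 C_{w,k}}\equiv0\Bigr\}.$$ **Proposition.** 1. There is $C>0$ such that $\mathcal E_{2,k,w}\le C\zeta^k$ for all $w\in T$ and $k\ge0$. 2. If $(\mathcal E,\mathcal F)$ is local, then there is $c>0$ such that $\mathcal E_{2,k,w}\ge c\,\zeta^k$ for all $w\in T$ and $k\ge0$ with $\mathcal C_{w,k}\neq\emptyset$. -/

import Mathlib

open scoped ENNReal

/-- A resistance form `(𝓔, 𝓕)` on a set `X`: `dom` is the space `𝓕` of real functions and `form` is
the symmetric bilinear form `𝓔` that belongs to the quadratic form `u ↦ 𝓔(u, u)`. -/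
structure ResistanceForm (X : Type*) where
  dom : Submodule ℝ (X → ℝ)
  form : dom →ₗ[ℝ] dom →ₗ[ℝ] ℝ
  symm : ∀ u v, form u v = form v u
  nonneg : ∀ u, 0 ≤ form u u
  one_mem : (fun _ => (1 : ℝ)) ∈ dom
  form_self_eq_zero_iff : ∀ u : dom, form u u = 0 ↔ ∃ c : ℝ, ∀ x, (u : X → ℝ) x = c
  /-- Every `𝓔`-Cauchy sequence converges: `𝓕` modulo constants is a Hilbert space. -/
  complete : ∀ u : ℕ → dom,
    (∀ ε > 0, ∃ N, ∀ m ≥ N, ∀ n ≥ N, form (u m - u n) (u m - u n) < ε) →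
      ∃ v : dom, Filter.Tendsto (fun n => form (u n - v) (u n - v)) Filter.atTop (nhds 0)
  separates : ∀ x y, x ≠ y → ∃ u : dom, (u : X → ℝ) x ≠ (u : X → ℝ) y
  /-- The reciprocal of the infimum is finite; the set is nonempty by `separates`. -/
  capacity_pos : ∀ x y, x ≠ y →
    0 < sInf {e : ℝ | ∃ u : dom, (u : X → ℝ) x = 1 ∧ (u : X → ℝ) y = 0 ∧ e = form u u}
  markov : ∀ u : dom, ∃ v : dom,
    (∀ x, (v : X → ℝ) x = max 0 (min 1 ((u : X → ℝ) x))) ∧ form v v ≤ form u u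

namespace ResistanceForm

variable {X : Type*} (𝓔 : ResistanceForm X)

/-- The energies `𝓔(u, u)` of the functions `u ∈ 𝓕` with `u x = 1` and `u y = 0`. -/
def energies (x y : X) : Set ℝ :=
  {e : ℝ | ∃ u : 𝓔.dom, (u : X → ℝ) x = 1 ∧ (u : X → ℝ) y = 0 ∧ e = 𝓔.form u u}

open Classical in
/-- The resistance metric `R`. -/
noncomputable def R (x y : X) : ℝ :=
  if x = y then 0 else (sInf (𝓔.energies x y))⁻¹

/-- `(𝓔, 𝓕)` is local: `𝓔(u, v) = 0` whenever `{u ≠ 0}` and `{v ≠ 0}` have positive `R`-distance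
(the distance to the empty set being infinite). -/
def IsLocal : Prop :=
  ∀ u v : 𝓔.dom,
    (∃ δ > 0, ∀ x y, (u : X → ℝ) x ≠ 0 → (v : X → ℝ) y ≠ 0 → δ ≤ 𝓔.R x y) → 𝓔.form u v = 0

/-! Proof that `R` is a metric. -/

theorem bddBelow_energies (x y : X) : BddBelow (𝓔.energies x y) :=
  ⟨0, by rintro _ ⟨u, -, -, rfl⟩; exact 𝓔.nonneg u⟩

theorem R_self (x : X) : 𝓔.R x x = 0 := by simp [R]

theorem R_pos {x y : X} (h : x ≠ y) : 0 < 𝓔.R x y := by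
  have h0 : 0 < sInf (𝓔.energies x y) := 𝓔.capacity_pos x y h
  simpa only [R, h, if_false, inv_pos] using h0

/-- The constant function `1` as an element of the domain. -/
def one : 𝓔.dom := ⟨fun _ => 1, 𝓔.one_mem⟩

theorem one_apply (x : X) : (𝓔.one : X → ℝ) x = 1 := rfl

theorem form_add_smul (u v : 𝓔.dom) (s : ℝ) :
    𝓔.form (u + s • v) (u + s • v) = 𝓔.form u u + 2 * s * 𝓔.form u v + s ^ 2 * 𝓔.form v v := by
  simp only [map_add, map_smul, LinearMap.add_apply, LinearMap.smul_apply, smul_eq_mul,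
    𝓔.symm v u]
  ring

theorem form_one_self : 𝓔.form 𝓔.one 𝓔.one = 0 :=
  (𝓔.form_self_eq_zero_iff _).2 ⟨1, fun _ => rfl⟩

theorem form_one_right (u : 𝓔.dom) : 𝓔.form u 𝓔.one = 0 := by
  by_contra h
  have h1 := 𝓔.nonneg (u + (-(𝓔.form u u + 1) / (2 * 𝓔.form u 𝓔.one)) • 𝓔.one)
  rw [form_add_smul, form_one_self] at h1
  have h2 : 2 * (-(𝓔.form u u + 1) / (2 * 𝓔.form u 𝓔.one)) * 𝓔.form u 𝓔.one
      = -(𝓔.form u u + 1) := by field_simp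
  rw [h2] at h1
  linarith

theorem form_shift (u : 𝓔.dom) (s : ℝ) :
    𝓔.form (u + s • 𝓔.one) (u + s • 𝓔.one) = 𝓔.form u u := by
  rw [form_add_smul, form_one_self, form_one_right]; ring

theorem form_smul_smul (u : 𝓔.dom) (s : ℝ) :
    𝓔.form (s • u) (s • u) = s ^ 2 * 𝓔.form u u := by
  simp only [map_smul, LinearMap.smul_apply, smul_eq_mul]; ring

theorem sq_sub_le {x y : X} (h : x ≠ y) (u : 𝓔.dom) :
    ((u : X → ℝ) x - (u : X → ℝ) y) ^ 2 ≤ 𝓔.R x y * 𝓔.form u u := by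
  have hR := 𝓔.R_pos h
  set d := (u : X → ℝ) x - (u : X → ℝ) y with hd
  rcases eq_or_ne d 0 with h0 | h0
  · rw [h0]
    have := mul_nonneg hR.le (𝓔.nonneg u)
    simpa using this
  · have hmem : (d⁻¹) ^ 2 * 𝓔.form u u ∈ 𝓔.energies x y := by
      refine ⟨d⁻¹ • (u + (-(u : X → ℝ) y) • 𝓔.one), ?_, ?_, ?_⟩
      · simp only [Submodule.coe_smul, Submodule.coe_add, Pi.smul_apply, Pi.add_apply,
          one_apply, smul_eq_mul, mul_one]
        rw [← sub_eq_add_neg, ← hd, inv_mul_cancel₀ h0]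
      · simp [one_apply]
      · rw [form_smul_smul, form_shift]
    have h1 := csInf_le (𝓔.bddBelow_energies x y) hmem
    have h2 : sInf (𝓔.energies x y) = (𝓔.R x y)⁻¹ := by simp [R, h]
    rw [h2, inv_pow, inv_mul_eq_div, le_div_iff₀ (by positivity)] at h1
    rwa [inv_mul_le_iff₀ hR] at h1

theorem energies_symm_subset (x y : X) : 𝓔.energies x y ⊆ 𝓔.energies y x := by
  rintro _ ⟨u, hx, hy, rfl⟩
  refine ⟨(-1 : ℝ) • u + (1 : ℝ) • 𝓔.one, ?_, ?_, ?_⟩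
  · simp [one_apply, hy]
  · simp [one_apply, hx]
  · rw [form_shift, form_smul_smul]; ring

theorem R_comm (x y : X) : 𝓔.R x y = 𝓔.R y x := by
  have : 𝓔.energies x y = 𝓔.energies y x :=
    (𝓔.energies_symm_subset x y).antisymm (𝓔.energies_symm_subset y x)
  rcases eq_or_ne x y with rfl | h
  · rfl
  · simp only [R, this, h, h.symm, if_false]

/-- Truncation at a level `t > 0` of a function with values in `[0, ∞)`. -/
theorem exists_truncation (u : 𝓔.dom) (hu : ∀ x, 0 ≤ (u : X → ℝ) x) {t : ℝ} (ht : 0 < t) :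
    ∃ v : 𝓔.dom, (∀ x, (v : X → ℝ) x = min t ((u : X → ℝ) x)) ∧ 𝓔.form v v ≤ 𝓔.form u u := by
  obtain ⟨v, hv, hE⟩ := 𝓔.markov (t⁻¹ • u)
  refine ⟨t • v, fun x => ?_, ?_⟩
  · have h1 : (0 : ℝ) ≤ min 1 (t⁻¹ * (u : X → ℝ) x) :=
      le_min zero_le_one (mul_nonneg (inv_nonneg.2 ht.le) (hu x))
    simp only [Submodule.coe_smul, Pi.smul_apply, smul_eq_mul, hv]
    rw [max_eq_right h1, mul_min_of_nonneg _ _ ht.le, mul_one, mul_inv_cancel_left₀ ht.ne']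
  · rw [form_smul_smul] at hE ⊢
    calc t ^ 2 * 𝓔.form v v ≤ t ^ 2 * (t⁻¹ ^ 2 * 𝓔.form u u) := by gcongr
      _ = 𝓔.form u u := by field_simp

theorem split_energy (u : 𝓔.dom) (hu : ∀ x, 0 ≤ (u : X → ℝ) x) {t : ℝ} (ht : 0 < t) :
    ∃ a : 𝓔.dom, (∀ x, (a : X → ℝ) x = min t ((u : X → ℝ) x)) ∧
      𝓔.form a a + 𝓔.form (u - a) (u - a) ≤ 𝓔.form u u := by
  obtain ⟨a, ha, -⟩ := 𝓔.exists_truncation u hu ht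
  refine ⟨a, ha, ?_⟩
  have key : ∀ s : ℝ, 0 < s →
      0 ≤ 2 * 𝓔.form a (u - a) + s * 𝓔.form (u - a) (u - a) := by
    intro s hs
    have hval : ∀ x, ((a + s • (u - a) : 𝓔.dom) : X → ℝ) x
        = min t ((u : X → ℝ) x) + s * ((u : X → ℝ) x - min t ((u : X → ℝ) x)) := by
      intro x; simp [ha]
    obtain ⟨c, hc, hE⟩ := 𝓔.exists_truncation (a + s • (u - a)) (fun x => by
      rw [hval]
      have := hu x
      have h1 : 0 ≤ min t ((u : X → ℝ) x) := le_min ht.le this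
      have h2 : 0 ≤ (u : X → ℝ) x - min t ((u : X → ℝ) x) := sub_nonneg.2 (min_le_right _ _)
      positivity) ht
    have hca : c = a := by
      ext x
      rw [hc, hval, ha]
      rcases le_total t ((u : X → ℝ) x) with h | h
      · rw [min_eq_left h]
        exact min_eq_left (le_add_of_nonneg_right (mul_nonneg hs.le (sub_nonneg.2 h)))
      · rw [min_eq_right h]; simp [h]
    rw [hca, form_add_smul] at hE
    have : 0 ≤ s * (2 * 𝓔.form a (u - a) + s * 𝓔.form (u - a) (u - a)) := by linarith
    exact nonneg_of_mul_nonneg_right this hs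
  have hcross : 0 ≤ 𝓔.form a (u - a) := by
    by_contra hneg
    push Not at hneg
    have hb := 𝓔.nonneg (u - a)
    have hb1 : 0 < 𝓔.form (u - a) (u - a) + 1 := by linarith
    have h := key (-𝓔.form a (u - a) / (𝓔.form (u - a) (u - a) + 1))
      (div_pos (neg_pos.2 hneg) hb1)
    have h3 : -𝓔.form a (u - a) / (𝓔.form (u - a) (u - a) + 1) * 𝓔.form (u - a) (u - a)
        ≤ -𝓔.form a (u - a) := by
      rw [div_mul_eq_mul_div, div_le_iff₀ hb1]
      nlinarith
    linarith
  have h := 𝓔.form_add_smul a (u - a) 1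
  simp only [one_smul, add_sub_cancel] at h
  linarith

theorem R_triangle (x y z : X) : 𝓔.R x z ≤ 𝓔.R x y + 𝓔.R y z := by
  rcases eq_or_ne x y with rfl | hxy
  · simp [R_self]
  rcases eq_or_ne y z with rfl | hyz
  · simp [R_self]
  have hα := 𝓔.R_pos hxy
  have hβ := 𝓔.R_pos hyz
  rcases eq_or_ne x z with rfl | hxz
  · rw [R_self]; linarith
  have hne : (𝓔.energies x z).Nonempty := by
    by_contra h
    have h0 : 0 < sInf (𝓔.energies x z) := 𝓔.capacity_pos x z hxz
    rw [Set.not_nonempty_iff_eq_empty.1 h, Real.sInf_empty] at h0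
    exact lt_irrefl _ h0
  have hle : (𝓔.R x y + 𝓔.R y z)⁻¹ ≤ sInf (𝓔.energies x z) := by
    refine le_csInf hne ?_
    rintro _ ⟨u, hx, hz, rfl⟩
    obtain ⟨v, hv, hE⟩ := 𝓔.markov u
    refine le_trans ?_ hE
    have hvx : (v : X → ℝ) x = 1 := by simp [hv, hx]
    have hvz : (v : X → ℝ) z = 0 := by simp [hv, hz]
    have hv0 : ∀ p, 0 ≤ (v : X → ℝ) p := fun p => by rw [hv]; exact le_max_left _ _
    have hv1 : ∀ p, (v : X → ℝ) p ≤ 1 := fun p => by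
      rw [hv]; exact max_le zero_le_one (min_le_left _ _)
    set t := (v : X → ℝ) y with ht
    have hsum : 0 < 𝓔.R x y + 𝓔.R y z := add_pos hα hβ
    have main : t ^ 2 / 𝓔.R y z + (1 - t) ^ 2 / 𝓔.R x y ≤ 𝓔.form v v := by
      rcases (hv0 y).eq_or_lt with h0 | h0
      · have h := 𝓔.sq_sub_le hxy v
        rw [hvx, ← ht] at h
        rw [← ht] at h0
        rw [← h0] at h ⊢
        rw [mul_comm] at h
        have := (div_le_iff₀ hα).2 h
        simpa using this
      · obtain ⟨a, ha, hs⟩ := 𝓔.split_energy v hv0 h0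
        have h1 := 𝓔.sq_sub_le hyz a
        have h2 := 𝓔.sq_sub_le hxy (v - a)
        have hax : (a : X → ℝ) x = t := by rw [ha, hvx]; exact min_eq_left (hv1 y)
        have hay : (a : X → ℝ) y = t := by rw [ha]; exact min_self _
        have haz : (a : X → ℝ) z = 0 := by rw [ha, hvz]; exact min_eq_right h0.le
        simp only [Submodule.coe_sub, Pi.sub_apply, hax, hay, haz, hvx, sub_zero, ← ht,
          sub_self] at h1 h2
        rw [mul_comm] at h1 h2
        have h1' := (div_le_iff₀ hβ).2 h1
        have h2' := (div_le_iff₀ hα).2 h2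
        linarith
    refine le_trans ?_ main
    rw [div_add_div _ _ hβ.ne' hα.ne', inv_eq_one_div, div_le_div_iff₀ hsum (by positivity)]
    nlinarith [sq_nonneg (t * 𝓔.R x y - (1 - t) * 𝓔.R y z)]
  have hR : 𝓔.R x z = (sInf (𝓔.energies x z))⁻¹ := by simp [R, hxz]
  rw [hR]
  exact inv_le_of_inv_le₀ (add_pos hα hβ) hle

/-- The set `X` regarded as the metric space `(X, R)`. -/
def Space {X : Type*} (_ : ResistanceForm X) : Type _ := X

noncomputable instance : MetricSpace 𝓔.Space where
  dist x y := 𝓔.R x y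
  dist_self := 𝓔.R_self
  dist_comm := 𝓔.R_comm
  dist_triangle := 𝓔.R_triangle
  eq_of_dist_eq_zero := by
    intro x y h
    by_contra hne
    exact (𝓔.R_pos hne).ne' h

end ResistanceForm

/-- A tree with a reference point `(T, π, φ)`. -/
structure RefTree (T : Type*) where
  π : T → T
  φ : T
  countable : Countable T
  periodic_subsingleton : {w : T | ∃ n ≥ 1, π^[n] w = w}.Subsingleton
  common_ancestor : ∀ w v : T, ∃ n m : ℕ, π^[n] w = π^[m] v
  φ_periodic : {w : T | ∃ n ≥ 1, π^[n] w = w}.Nonempty → ∃ n ≥ 1, π^[n] φ = φ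

namespace RefTree

variable {T : Type*} (𝒯 : RefTree T)

/-- `b(w, v)`: the number of steps from `w` up to the first common ancestor of `w` and `v`. -/
noncomputable def b (w v : T) : ℕ := sInf {n : ℕ | ∃ m : ℕ, 𝒯.π^[n] w = 𝒯.π^[m] v}

/-- The level `[w]`. The set `T_n` is `{w | 𝒯.level w = n}`. -/
noncomputable def level (w : T) : ℤ := (𝒯.b w 𝒯.φ : ℤ) - (𝒯.b 𝒯.φ w : ℤ)

/-- `π^{-k}(w) ∩ T_{[w]+k}`. -/
def descendants (w : T) (k : ℕ) : Set T :=
  {v | 𝒯.π^[k] v = w ∧ 𝒯.level v = 𝒯.level w + k}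

/-- The disjoint union over `n` of the graphs `(T_n, E_n)`: cells of the same level are adjacent
if they are distinct and intersect. Its extended distance `edist` restricted to `T_n` is `l_n`,
with value `⊤` when there is no path. -/
def cellGraph {Y : Type*} (K : T → Set Y) : SimpleGraph T where
  Adj w v := 𝒯.level w = 𝒯.level v ∧ (K w ∩ K v).Nonempty ∧ w ≠ v
  symm := ⟨fun _ _ h => ⟨h.1.symm, by rw [Set.inter_comm]; exact h.2.1, h.2.2.symm⟩⟩
  loopless := ⟨fun _ h => h.2.2 rfl⟩

/-- `K` is a partition of the metric space `Y` parametrized by `(T, π, φ)`. -/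
structure IsPartition {Y : Type*} [MetricSpace Y] (K : T → Set Y) : Prop where
  no_isolated : ∀ y : Y, (nhdsWithin y {y}ᶜ).NeBot
  isCompact : ∀ w, IsCompact (K w)
  /-- `K w` is neither empty nor a single point. -/
  nontrivial : ∀ w, (K w).Nontrivial
  cover : ⋃ w ∈ {w | 𝒯.level w = 0}, K w = Set.univ
  subdivision : ∀ w, ⋃ v ∈ 𝒯.descendants w 1, K v = K w
  /-- The cells along a descending path of the tree shrink to a point. -/
  inter_singleton : ∀ w : ℕ → T, (∀ k, 𝒯.level (w k) = k) → (∀ k, 𝒯.π (w (k + 1)) = w k) →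
    ∃ y, ⋂ k, K (w k) = {y}

/-- The set of `n` such that `x` and `y` lie in cells of level `n` at graph distance at most `m`;
`Δ_m(x, y)` is its supremum. -/
def linkLevels {Y : Type*} (K : T → Set Y) (m : ℕ) (x y : Y) : Set ℤ :=
  {n | ∃ w v, 𝒯.level w = n ∧ 𝒯.level v = n ∧ x ∈ K w ∧ y ∈ K v ∧ (𝒯.cellGraph K).edist w v ≤ m}

/-- The partition `K` satisfies the basic framework, with scale `ζ` and with the number `M`
(usually written `M_*`) of steps in the comparison of distances. -/
structure IsBasicFramework {Y : Type*} [MetricSpace Y] (K : T → Set Y) (ζ : ℝ) (M : ℕ) :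
    Prop extends 𝒯.IsPartition K where
  bounded_branching : ∃ N : ℕ, ∀ w, (𝒯.descendants w 1).encard ≤ N
  disjoint_interiors : ∀ w v, 𝒯.level w = 𝒯.level v → w ≠ v →
    interior (K w) ∩ interior (K v) = ∅
  scale_pos : 0 < ζ
  scale_lt_one : ζ < 1
  diam_comparable : ∃ c > 0, ∃ C > 0, ∀ w,
    c * ζ ^ 𝒯.level w ≤ Metric.diam (K w) ∧ Metric.diam (K w) ≤ C * ζ ^ 𝒯.level w
  contains_ball : ∃ ξ > 0, ∀ w, ∃ x ∈ K w, Metric.ball x (ξ * ζ ^ 𝒯.level w) ⊆ K w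
  /-- `ρ(x, y) ≍ ζ ^ Δ_M(x, y)`. For `x = y` both sides are `0`, as `Δ_M(x, x) = ∞`; for `x ≠ y`
  the comparison includes that the supremum `Δ_M(x, y)` is finite. -/
  dist_comparable : ∃ c > 0, ∃ C > 0, ∀ x y, x ≠ y → ∃ n : ℤ, IsLUB (𝒯.linkLevels K M x y) n ∧
    c * ζ ^ n ≤ dist x y ∧ dist x y ≤ C * ζ ^ n
  bounded_degree : ∃ L : ℕ, ∀ w, {v | (𝒯.cellGraph K).Adj w v}.encard ≤ L

/-- `𝓔²_n(f) = (1/2) ∑_{(u,v) ∈ E_n} |f(u) - f(v)|²`, a sum over ordered pairs, with values in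
`[0, ∞]`. Only the values of `f` on `T_n` matter. -/
noncomputable def discreteEnergy {Y : Type*} (K : T → Set Y) (n : ℤ) (f : T → ℝ) : ℝ≥0∞ :=
  (∑' e : {e : T × T // 𝒯.level e.1 = n ∧ (𝒯.cellGraph K).Adj e.1 e.2},
    ENNReal.ofReal ((f e.1.1 - f e.1.2) ^ 2)) / 2

/-- `𝒞_{w,k}`: the cells of level `[w] + k` whose `k`-th ancestor has distance more than `M` from
`w`. -/
def farCells {Y : Type*} (K : T → Set Y) (M : ℕ) (w : T) (k : ℕ) : Set T :=
  {v | 𝒯.level v = 𝒯.level w + k ∧ (M : ℕ∞) < (𝒯.cellGraph K).edist w (𝒯.π^[k] v)}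

/-- `𝓔_{2,k,w}`. -/
noncomputable def energy₂ {Y : Type*} (K : T → Set Y) (M : ℕ) (k : ℕ) (w : T) : ℝ≥0∞ :=
  ⨅ f ∈ {f : T → ℝ | (∀ v ∈ 𝒯.descendants w k, f v = 1) ∧ ∀ v ∈ 𝒯.farCells K M w k, f v = 0},
    𝒯.discreteEnergy K (𝒯.level w + k) f

end RefTree

/-! Both bounds come from passing between functions on `X` and functions on the cells of a single
level `n = [w] + k`. Up to constants, one unit of `𝓔`-energy corresponds to `ζ ^ n` units of
discrete energy. Separating `K w` from the cells more than `M` steps away means separating points at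
distance of order `ζ ^ [w]`, which costs `𝓔`-energy of order `ζ ^ (-[w])`. The product of the two
factors is `ζ ^ k`.

Upper bound. The framework makes `(X, R)` doubling (`metricallyDoubling`). Then boundedly many
two-point separators per dyadic annulus, with geometrically decaying energies, add up to cutoff
functions of energy `O(1/s)` at scale `s` (`exists_point_cutoff`, `exists_cutoff`). Such a cutoff at
scale `ζ ^ [w]`, sampled at interior centers of the cells of level `n`, is a competitor for
`energy₂`. It remains to see that sampling is bounded (`exists_discreteEnergy_le`). Since locality
is not available here, energy is localized through the trace on a finite set of centers, a network
of nonnegative conductances (`exists_trace`). A local Poincaré inequality (`exists_local_poincare`)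
bounds the difference across an edge by the energy of the conductances that start in a ball of
radius comparable to `ζ ^ n`, and these balls have bounded overlap.

Lower bound. For a local form there is a bounded map in the other direction
(`exists_interpolation`): a competitor `f` is interpolated by `∑ f v • φ v` with a partition of
unity `φ` at scale `ζ ^ n`. Locality kills the interaction of distant `φ v` and makes the relevant
row sums of the matrix `𝓔(φ v, φ v')` vanish, so the energy is a sum of squared differences over
nearby cells. Locality also forces some far cell to lie at distance `O(ζ ^ [w])` from `w`
(`exists_far_point`), and the estimate `|u x - u y|² ≤ R(x, y) 𝓔(u, u)` between this cell and `w`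
bounds the energy below. -/

namespace ResistanceForm

/-! ### The energy seminorm, separators and energy minimizers. -/

variable {X : Type*} (𝓔 : ResistanceForm X)

/-- The value of `u ∈ 𝓕` at a point of the metric space `(X, R)`. -/
def ev (u : 𝓔.dom) (x : 𝓔.Space) : ℝ := (u : X → ℝ) x

@[simp] theorem ev_add (u v : 𝓔.dom) (x : 𝓔.Space) : 𝓔.ev (u + v) x = 𝓔.ev u x + 𝓔.ev v x := rfl

@[simp] theorem ev_sub (u v : 𝓔.dom) (x : 𝓔.Space) : 𝓔.ev (u - v) x = 𝓔.ev u x - 𝓔.ev v x := rfl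

@[simp] theorem ev_smul (s : ℝ) (u : 𝓔.dom) (x : 𝓔.Space) : 𝓔.ev (s • u) x = s * 𝓔.ev u x := rfl

@[simp] theorem ev_one (x : 𝓔.Space) : 𝓔.ev 𝓔.one x = 1 := rfl

@[simp] theorem ev_zero (x : 𝓔.Space) : 𝓔.ev 0 x = 0 := rfl

@[simp] theorem ev_sum {ι : Type*} (s : Finset ι) (u : ι → 𝓔.dom) (x : 𝓔.Space) :
    𝓔.ev (∑ i ∈ s, u i) x = ∑ i ∈ s, 𝓔.ev (u i) x := by
  classical
  induction s using Finset.induction_on with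
  | empty => simp
  | insert a s ha ih => rw [Finset.sum_insert ha, Finset.sum_insert ha, ev_add, ih]

theorem dist_eq_R (x y : 𝓔.Space) : dist x y = 𝓔.R x y := rfl

theorem ev_sub_sq_le (u : 𝓔.dom) (x y : 𝓔.Space) :
    (𝓔.ev u x - 𝓔.ev u y) ^ 2 ≤ dist x y * 𝓔.form u u := by
  rcases eq_or_ne x y with rfl | h
  · simp
  · exact 𝓔.sq_sub_le h u

theorem exists_clamp (u : 𝓔.dom) : ∃ v : 𝓔.dom,
    (∀ x, 𝓔.ev v x = max 0 (min 1 (𝓔.ev u x))) ∧ 𝓔.form v v ≤ 𝓔.form u u :=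
  𝓔.markov u

theorem form_sq_le (u v : 𝓔.dom) : 𝓔.form u v ^ 2 ≤ 𝓔.form u u * 𝓔.form v v := by
  have h := discrim_le_zero (a := 𝓔.form v v) (b := 2 * 𝓔.form u v) (c := 𝓔.form u u) (by
    intro s
    have := 𝓔.nonneg (u + s • v)
    rw [form_add_smul] at this
    linarith)
  rw [discrim] at h
  linarith

/-- The seminorm `u ↦ 𝓔(u, u)^(1/2)`. -/
noncomputable def enorm₂ (u : 𝓔.dom) : ℝ := √(𝓔.form u u)

theorem enorm₂_nonneg (u : 𝓔.dom) : 0 ≤ 𝓔.enorm₂ u := Real.sqrt_nonneg _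

theorem enorm₂_sq (u : 𝓔.dom) : 𝓔.enorm₂ u ^ 2 = 𝓔.form u u := Real.sq_sqrt (𝓔.nonneg u)

theorem enorm₂_zero : 𝓔.enorm₂ 0 = 0 := by simp [enorm₂]

theorem abs_form_le (u v : 𝓔.dom) : |𝓔.form u v| ≤ 𝓔.enorm₂ u * 𝓔.enorm₂ v := by
  apply abs_le_of_sq_le_sq _ (mul_nonneg (𝓔.enorm₂_nonneg u) (𝓔.enorm₂_nonneg v))
  rw [mul_pow, enorm₂_sq, enorm₂_sq]
  exact 𝓔.form_sq_le u v

theorem enorm₂_add_le (u v : 𝓔.dom) : 𝓔.enorm₂ (u + v) ≤ 𝓔.enorm₂ u + 𝓔.enorm₂ v := by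
  apply le_of_sq_le_sq _ (add_nonneg (𝓔.enorm₂_nonneg u) (𝓔.enorm₂_nonneg v))
  have h := 𝓔.form_add_smul u v 1
  rw [one_smul] at h
  have h1 := (abs_le.1 (𝓔.abs_form_le u v)).2
  rw [add_sq, enorm₂_sq, enorm₂_sq, enorm₂_sq, h]
  linarith

theorem enorm₂_smul (s : ℝ) (u : 𝓔.dom) : 𝓔.enorm₂ (s • u) = |s| * 𝓔.enorm₂ u := by
  rw [enorm₂, form_smul_smul, Real.sqrt_mul (sq_nonneg s), Real.sqrt_sq_eq_abs, enorm₂]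

theorem sub_eq_add_smul (u v : 𝓔.dom) : u - v = u + (-1 : ℝ) • v := by
  ext x
  simp [sub_eq_add_neg]

theorem enorm₂_sub_le (u v : 𝓔.dom) : 𝓔.enorm₂ (u - v) ≤ 𝓔.enorm₂ u + 𝓔.enorm₂ v := by
  have h := 𝓔.enorm₂_add_le u ((-1 : ℝ) • v)
  rw [enorm₂_smul] at h
  rw [sub_eq_add_smul]
  simpa using h

theorem enorm₂_sum_le {ι : Type*} (s : Finset ι) (u : ι → 𝓔.dom) :
    𝓔.enorm₂ (∑ i ∈ s, u i) ≤ ∑ i ∈ s, 𝓔.enorm₂ (u i) :=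
  Finset.le_sum_of_subadditive _ 𝓔.enorm₂_zero.le 𝓔.enorm₂_add_le _ _

theorem form_sum_le {ι : Type*} (s : Finset ι) (u : ι → 𝓔.dom) {B : ℝ} {N : ℕ}
    (hB0 : 0 ≤ B) (hs : s.card ≤ N) (hB : ∀ i ∈ s, 𝓔.form (u i) (u i) ≤ B) :
    𝓔.form (∑ i ∈ s, u i) (∑ i ∈ s, u i) ≤ (N : ℝ) ^ 2 * B := by
  have h1 : 𝓔.enorm₂ (∑ i ∈ s, u i) ≤ N * √B := by
    refine (𝓔.enorm₂_sum_le s u).trans ?_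
    refine (Finset.sum_le_card_nsmul s _ (√B) fun i hi => Real.sqrt_le_sqrt (hB i hi)).trans ?_
    rw [nsmul_eq_mul]
    gcongr
  rw [← enorm₂_sq]
  calc 𝓔.enorm₂ (∑ i ∈ s, u i) ^ 2 ≤ (N * √B) ^ 2 := by
        gcongr; exact 𝓔.enorm₂_nonneg _
    _ = (N : ℝ) ^ 2 * B := by rw [mul_pow, Real.sq_sqrt hB0]

/-- The factor 2 leaves room to take a near-minimizer of the infimum that defines `R`; truncation to
`[0, 1]` does not raise its energy. -/
theorem exists_separator {x y : 𝓔.Space} (h : x ≠ y) : ∃ g : 𝓔.dom,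
    (∀ z, 0 ≤ 𝓔.ev g z ∧ 𝓔.ev g z ≤ 1) ∧ 𝓔.ev g x = 0 ∧ 𝓔.ev g y = 1 ∧
      𝓔.form g g ≤ 2 / dist x y := by
  have h0 : 0 < sInf (𝓔.energies y x) := 𝓔.capacity_pos y x h.symm
  have hne : (𝓔.energies y x).Nonempty := by
    by_contra hn
    rw [Set.not_nonempty_iff_eq_empty.1 hn, Real.sInf_empty] at h0
    exact lt_irrefl _ h0
  obtain ⟨_, ⟨u, hy, hx, rfl⟩, hu⟩ := exists_lt_of_csInf_lt hne (by linarith :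
    sInf (𝓔.energies y x) < 2 * sInf (𝓔.energies y x))
  obtain ⟨g, hg, hE⟩ := 𝓔.exists_clamp u
  have hR : dist x y = (sInf (𝓔.energies y x))⁻¹ := by
    rw [dist_comm, dist_eq_R]
    exact if_neg h.symm
  refine ⟨g, fun z => ?_, ?_, ?_, ?_⟩
  · rw [hg]
    exact ⟨le_max_left _ _, max_le zero_le_one (min_le_left _ _)⟩
  · rw [hg, show 𝓔.ev u x = 0 from hx]; simp
  · rw [hg, show 𝓔.ev u y = 1 from hy]; simp
  · rw [hR, div_inv_eq_mul]
    linarith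

/-- Sums of nonnegative functions with geometrically decaying energies. -/
theorem exists_ge_of_geometric (g : ℕ → 𝓔.dom) (x₀ : 𝓔.Space) (B q : ℝ) (hq0 : 0 ≤ q)
    (hq1 : q < 1) (hx₀ : ∀ j, 𝓔.ev (g j) x₀ = 0) (hg : ∀ j x, 0 ≤ 𝓔.ev (g j) x)
    (hE : ∀ j, 𝓔.enorm₂ (g j) ≤ B * q ^ j) :
    ∃ G : 𝓔.dom, 𝓔.ev G x₀ = 0 ∧ (∀ j x, 𝓔.ev (g j) x ≤ 𝓔.ev G x) ∧
      𝓔.enorm₂ G ≤ B / (1 - q) := by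
  have hB : 0 ≤ B := by simpa using (𝓔.enorm₂_nonneg _).trans (hE 0)
  have hq : 0 < 1 - q := by linarith
  set S : ℕ → 𝓔.dom := fun n => ∑ j ∈ Finset.range n, g j with hS
  have hIco : ∀ m n, m ≤ n → 𝓔.enorm₂ (S n - S m) ≤ B / (1 - q) * q ^ m := by
    intro m n hmn
    have h1 : S n - S m = ∑ j ∈ Finset.Ico m n, g j := by
      rw [Finset.sum_Ico_eq_sub _ hmn]
    rw [h1]
    refine (𝓔.enorm₂_sum_le _ _).trans ?_
    refine (Finset.sum_le_sum fun j _ => hE j).trans ?_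
    rw [← Finset.mul_sum]
    have h2 := geom_sum_Ico_le_of_lt_one (m := m) (n := n) hq0 hq1
    calc B * ∑ j ∈ Finset.Ico m n, q ^ j ≤ B * (q ^ m / (1 - q)) := by gcongr
      _ = B / (1 - q) * q ^ m := by ring
  have htend : Filter.Tendsto (fun m => B / (1 - q) * q ^ m) Filter.atTop (nhds 0) := by
    simpa using (tendsto_pow_atTop_nhds_zero_of_lt_one hq0 hq1).const_mul (B / (1 - q))
  obtain ⟨v, hv⟩ := 𝓔.complete S (by
    intro ε hε
    obtain ⟨N, hN⟩ := (htend.eventually (gt_mem_nhds (Real.sqrt_pos.2 hε))).exists_forall_of_atTop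
    have key : ∀ m n, N ≤ m → m ≤ n → 𝓔.enorm₂ (S n - S m) < √ε := fun m n hm hmn =>
      (hIco m n hmn).trans_lt (hN m hm)
    have key' : ∀ m ≥ N, ∀ n ≥ N, 𝓔.enorm₂ (S m - S n) < √ε := by
      intro m hm n hn
      rcases le_total m n with h | h
      · have h3 := key m n hm h
        have : S m - S n = (-1 : ℝ) • (S n - S m) := by
          ext x
          simp
        rw [this, enorm₂_smul]
        simpa using h3
      · exact key n m hn h
    refine ⟨N, fun m hm n hn => ?_⟩
    rw [← enorm₂_sq]
    have := key' m hm n hn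
    calc 𝓔.enorm₂ (S m - S n) ^ 2 < √ε ^ 2 := by
          gcongr; exact 𝓔.enorm₂_nonneg _
      _ = ε := Real.sq_sqrt hε.le)
  -- Completeness yields a limit only modulo constants. All partial sums vanish at `x₀`, and this
  -- fixes the constant and gives pointwise convergence.
  have hlim : ∀ x, Filter.Tendsto (fun n => 𝓔.ev (S n) x) Filter.atTop
      (nhds (𝓔.ev v x - 𝓔.ev v x₀)) := by
    intro x
    rw [tendsto_iff_dist_tendsto_zero]
    have h1 : Filter.Tendsto (fun n => √(dist x x₀ * 𝓔.form (S n - v) (S n - v))) Filter.atTop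
        (nhds 0) := by
      have := (hv.const_mul (dist x x₀)).sqrt
      simpa using this
    refine squeeze_zero (fun _ => dist_nonneg) (fun n => ?_) h1
    rw [Real.dist_eq]
    apply Real.abs_le_sqrt
    have h2 := 𝓔.ev_sub_sq_le (S n - v) x x₀
    have h3 : 𝓔.ev (S n) x₀ = 0 := by simp [hS, hx₀]
    rw [ev_sub, ev_sub, h3] at h2
    convert h2 using 2
    ring
  have hval : ∀ x, 𝓔.ev (v + (-𝓔.ev v x₀) • 𝓔.one) x = 𝓔.ev v x - 𝓔.ev v x₀ := by
    intro x; simp [sub_eq_add_neg]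
  refine ⟨v + (-𝓔.ev v x₀) • 𝓔.one, ?_, fun j x => ?_, ?_⟩
  · rw [hval, sub_self]
  · rw [hval]
    refine ge_of_tendsto (hlim x) ?_
    filter_upwards [Filter.eventually_gt_atTop j] with n hn
    simp only [hS, ev_sum]
    exact Finset.single_le_sum (f := fun i => 𝓔.ev (g i) x) (fun i _ => hg i x)
      (Finset.mem_range.2 hn)
  · have h1 : 𝓔.enorm₂ (v + (-𝓔.ev v x₀) • 𝓔.one) = 𝓔.enorm₂ v := by
      rw [enorm₂, form_shift, enorm₂]
    rw [h1]
    have h2 : Filter.Tendsto (fun n => B / (1 - q) + 𝓔.enorm₂ (S n - v)) Filter.atTop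
        (nhds (B / (1 - q) + 0)) := by
      refine Filter.Tendsto.const_add _ ?_
      simpa [enorm₂] using hv.sqrt
    rw [add_zero] at h2
    refine ge_of_tendsto' h2 fun n => ?_
    have h3 := 𝓔.enorm₂_sub_le (S n) (S n - v)
    rw [sub_sub_cancel] at h3
    have h4 := hIco 0 n (Nat.zero_le n)
    simp only [hS, Finset.range_zero, Finset.sum_empty, sub_zero, pow_zero, mul_one] at h4
    exact h3.trans (by simpa [hS] using h4)

/-- Energy minimizers with prescribed values on a nonempty set. -/
theorem exists_harmonic (V : Set 𝓔.Space) (hV : V.Nonempty) (u₀ : 𝓔.dom) :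
    ∃ h : 𝓔.dom, (∀ a ∈ V, 𝓔.ev h a = 𝓔.ev u₀ a) ∧
      ∀ φ : 𝓔.dom, (∀ a ∈ V, 𝓔.ev φ a = 0) → 𝓔.form h φ = 0 := by
  obtain ⟨x₀, hx₀⟩ := hV
  set 𝒜 : Set 𝓔.dom := {u | ∀ a ∈ V, 𝓔.ev u a = 𝓔.ev u₀ a} with h𝒜
  set m := sInf ((fun u => 𝓔.form u u) '' 𝒜) with hm
  have hbdd : BddBelow ((fun u => 𝓔.form u u) '' 𝒜) :=
    ⟨0, by rintro _ ⟨u, -, rfl⟩; exact 𝓔.nonneg u⟩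
  have hmle : ∀ u ∈ 𝒜, m ≤ 𝓔.form u u := fun u hu => csInf_le hbdd ⟨u, hu, rfl⟩
  have hex : ∀ n : ℕ, ∃ u ∈ 𝒜, 𝓔.form u u < m + 1 / ((n : ℝ) + 1) := by
    intro n
    obtain ⟨_, ⟨u, hu, rfl⟩, h⟩ := exists_lt_of_csInf_lt (s := (fun u => 𝓔.form u u) '' 𝒜)
      ⟨_, u₀, fun _ _ => rfl, rfl⟩ (show m < m + 1 / ((n : ℝ) + 1) by
        have : 0 < 1 / ((n : ℝ) + 1) := by positivity
        linarith)
    exact ⟨u, hu, h⟩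
  choose u hu𝒜 huE using hex
  -- Parallelogram identity: the midpoint of two competitors is a competitor, so a minimizing
  -- sequence is Cauchy.
  have hpar : ∀ p q : ℕ, 𝓔.form (u p - u q) (u p - u q)
      ≤ 2 * (1 / ((p : ℝ) + 1)) + 2 * (1 / ((q : ℝ) + 1)) := by
    intro p q
    have hmid : (1 / 2 : ℝ) • (u p + u q) ∈ 𝒜 := by
      intro a ha
      rw [ev_smul, ev_add, hu𝒜 p a ha, hu𝒜 q a ha]; ring
    have h1 := hmle _ hmid
    rw [form_smul_smul] at h1
    have h2 := 𝓔.form_add_smul (u p) (u q) 1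
    have h3 := 𝓔.form_add_smul (u p) (u q) (-1)
    rw [one_smul] at h2
    rw [← sub_eq_add_smul] at h3
    have h4 := huE p
    have h5 := huE q
    linarith
  obtain ⟨v, hv⟩ := 𝓔.complete u (by
    intro ε hε
    obtain ⟨N, hN⟩ := exists_nat_one_div_lt (show 0 < ε / 4 by linarith)
    refine ⟨N, fun p hp q hq => (hpar p q).trans_lt ?_⟩
    have h1 : 1 / ((p : ℝ) + 1) ≤ 1 / ((N : ℝ) + 1) := by gcongr
    have h2 : 1 / ((q : ℝ) + 1) ≤ 1 / ((N : ℝ) + 1) := by gcongr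
    linarith)
  have hconst : ∀ a ∈ V, 𝓔.ev v a - 𝓔.ev v x₀ = 𝓔.ev u₀ a - 𝓔.ev u₀ x₀ := by
    intro a ha
    have h1 : Filter.Tendsto (fun n => dist a x₀ * 𝓔.form (u n - v) (u n - v)) Filter.atTop
        (nhds 0) := by simpa using hv.const_mul (dist a x₀)
    have h2 : (𝓔.ev u₀ a - 𝓔.ev v a - (𝓔.ev u₀ x₀ - 𝓔.ev v x₀)) ^ 2 ≤ 0 := by
      refine ge_of_tendsto' h1 fun n => ?_
      have h3 := 𝓔.ev_sub_sq_le (u n - v) a x₀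
      rwa [ev_sub, ev_sub, hu𝒜 n a ha, hu𝒜 n x₀ hx₀] at h3
    have h3 := pow_eq_zero_iff (two_ne_zero) |>.1 (le_antisymm h2 (sq_nonneg _))
    linarith
  have horth : ∀ φ : 𝓔.dom, (∀ a ∈ V, 𝓔.ev φ a = 0) → 𝓔.form v φ = 0 := by
    intro φ hφ
    have hlim : Filter.Tendsto (fun n => 𝓔.form (u n) φ) Filter.atTop (nhds (𝓔.form v φ)) := by
      rw [tendsto_iff_dist_tendsto_zero]
      have h1 : Filter.Tendsto (fun n => 𝓔.enorm₂ (u n - v) * 𝓔.enorm₂ φ) Filter.atTop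
          (nhds 0) := by
        have : Filter.Tendsto (fun n => 𝓔.enorm₂ (u n - v)) Filter.atTop (nhds 0) := by
          simpa [enorm₂] using hv.sqrt
        simpa using this.mul_const (𝓔.enorm₂ φ)
      refine squeeze_zero (fun _ => dist_nonneg) (fun n => ?_) h1
      rw [Real.dist_eq]
      have := 𝓔.abs_form_le (u n - v) φ
      simpa [map_sub, LinearMap.sub_apply] using this
    -- First variation: `u n + s • φ` is still a competitor. Passing to the limit gives a quadratic
    -- in `s` without constant term that is nonnegative, so its linear coefficient vanishes.
    have hquad : ∀ s : ℝ, 0 ≤ 2 * s * 𝓔.form v φ + s ^ 2 * 𝓔.form φ φ := by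
      intro s
      have h1 : Filter.Tendsto (fun n : ℕ => 1 / ((n : ℝ) + 1) + 2 * s * 𝓔.form (u n) φ
          + s ^ 2 * 𝓔.form φ φ) Filter.atTop
          (nhds (0 + 2 * s * 𝓔.form v φ + s ^ 2 * 𝓔.form φ φ)) :=
        ((tendsto_one_div_add_atTop_nhds_zero_nat).add (hlim.const_mul _)).add_const _
      rw [zero_add] at h1
      refine ge_of_tendsto' h1 fun n => ?_
      have h2 := hmle (u n + s • φ) (by
        intro a ha
        rw [ev_add, ev_smul, hφ a ha, hu𝒜 n a ha]; ring)
      rw [form_add_smul] at h2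
      have h3 := huE n
      linarith
    have h := discrim_le_zero (a := 𝓔.form φ φ) (b := 2 * 𝓔.form v φ) (c := 0) (by
      intro s
      have := hquad s
      linarith)
    rw [discrim] at h
    nlinarith [sq_nonneg (𝓔.form v φ)]
  refine ⟨v + (𝓔.ev u₀ x₀ - 𝓔.ev v x₀) • 𝓔.one, fun a ha => ?_, fun φ hφ => ?_⟩
  · have := hconst a ha
    simp only [ev_add, ev_smul, ev_one]
    linarith
  · rw [map_add, LinearMap.add_apply, map_smul, LinearMap.smul_apply, horth φ hφ, 𝓔.symm,
      form_one_right]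
    simp

end ResistanceForm

/-- The quadratic form of a symmetric matrix with vanishing row sums in terms of differences. -/
theorem sum_sum_mul_sub_sq {ι : Type*} (s : Finset ι) (A : ι → ι → ℝ) (f : ι → ℝ)
    (hsymm : ∀ a b, A a b = A b a) (hrow : ∀ a ∈ s, f a ^ 2 * ∑ b ∈ s, A a b = 0) :
    ∑ a ∈ s, ∑ b ∈ s, A a b * (f a - f b) ^ 2 = -2 * ∑ a ∈ s, ∑ b ∈ s, f a * f b * A a b := by
  have h1 : ∑ a ∈ s, ∑ b ∈ s, f a ^ 2 * A a b = 0 := by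
    refine Finset.sum_eq_zero fun a ha => ?_
    rw [← Finset.mul_sum, hrow a ha]
  have h2 : ∑ a ∈ s, ∑ b ∈ s, f b ^ 2 * A a b = 0 := by
    rw [Finset.sum_comm, ← h1]
    refine Finset.sum_congr rfl fun a _ => Finset.sum_congr rfl fun b _ => ?_
    rw [hsymm]
  have h3 : ∑ a ∈ s, ∑ b ∈ s, A a b * (f a - f b) ^ 2
      = ∑ a ∈ s, ∑ b ∈ s, f a ^ 2 * A a b + ∑ a ∈ s, ∑ b ∈ s, f b ^ 2 * A a b
        + -2 * ∑ a ∈ s, ∑ b ∈ s, f a * f b * A a b := by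
    simp only [Finset.mul_sum, ← Finset.sum_add_distrib]
    refine Finset.sum_congr rfl fun a _ => Finset.sum_congr rfl fun b _ => ?_
    ring
  rw [h3, h1, h2]; ring

/-! ### Traces on finite sets. -/

namespace ResistanceForm

variable {X : Type*} (𝓔 : ResistanceForm X)

theorem form_sum_smul {ι : Type*} (s : Finset ι) (f : ι → ℝ) (h : ι → 𝓔.dom) :
    𝓔.form (∑ a ∈ s, f a • h a) (∑ a ∈ s, f a • h a)
      = ∑ a ∈ s, ∑ b ∈ s, f a * f b * 𝓔.form (h a) (h b) := by
  simp only [map_sum, LinearMap.sum_apply, map_smul, LinearMap.smul_apply, smul_eq_mul]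
  simp only [Finset.mul_sum]
  rw [Finset.sum_comm]
  refine Finset.sum_congr rfl fun a _ => Finset.sum_congr rfl fun b _ => ?_
  ring

/-- Separators of `a` from the other points of `V` are added, truncated at 1 and subtracted from 1.
-/
theorem exists_indicator (V : Finset 𝓔.Space) (a : 𝓔.Space) :
    ∃ g : 𝓔.dom, 𝓔.ev g a = 1 ∧ ∀ b ∈ V, b ≠ a → 𝓔.ev g b = 0 := by
  classical
  have hsep : ∀ b : 𝓔.Space, ∃ g : 𝓔.dom, (∀ z, 0 ≤ 𝓔.ev g z) ∧ 𝓔.ev g a = 0 ∧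
      (b ≠ a → 𝓔.ev g b = 1) := by
    intro b
    rcases eq_or_ne b a with rfl | h
    · exact ⟨0, fun z => by simp, by simp, fun h => absurd rfl h⟩
    · obtain ⟨g, h1, h2, h3, -⟩ := 𝓔.exists_separator h.symm
      exact ⟨g, fun z => (h1 z).1, h2, fun _ => h3⟩
  choose g hg0 hga hgb using hsep
  obtain ⟨v, hv, -⟩ := 𝓔.exists_clamp (∑ b ∈ V, g b)
  refine ⟨𝓔.one - v, ?_, fun b hb hba => ?_⟩
  · simp [hv, hga]
  · have h1 : 1 ≤ ∑ i ∈ V, 𝓔.ev (g i) b := by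
      rw [← hgb b hba]
      exact Finset.single_le_sum (f := fun i => 𝓔.ev (g i) b) (fun i _ => hg0 i b) hb
    simp [hv, min_eq_left h1]

/-- The trace of a resistance form on a finite set: a network of nonnegative conductances. -/
theorem exists_trace (V : Finset 𝓔.Space) (hV : V.Nonempty) :
    ∃ c : 𝓔.Space → 𝓔.Space → ℝ, (∀ a ∈ V, ∀ b ∈ V, 0 ≤ c a b) ∧
      (∀ u : 𝓔.dom, (∑ a ∈ V, ∑ b ∈ V, c a b * (𝓔.ev u a - 𝓔.ev u b) ^ 2) / 2 ≤ 𝓔.form u u) ∧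
      ∀ f : 𝓔.Space → ℝ, ∃ u : 𝓔.dom, (∀ a ∈ V, 𝓔.ev u a = f a) ∧
        𝓔.form u u = (∑ a ∈ V, ∑ b ∈ V, c a b * (f a - f b) ^ 2) / 2 := by
  classical
  have hex : ∀ a : 𝓔.Space, ∃ h : 𝓔.dom, (a ∈ V → ∀ b ∈ V, 𝓔.ev h b = if b = a then 1 else 0) ∧
      ∀ φ : 𝓔.dom, (∀ b ∈ V, 𝓔.ev φ b = 0) → 𝓔.form h φ = 0 := by
    intro a
    obtain ⟨g, hg1, hg0⟩ := 𝓔.exists_indicator V a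
    obtain ⟨h, hh, ho⟩ := 𝓔.exists_harmonic (V : Set 𝓔.Space) hV g
    refine ⟨h, fun _ b hb => ?_, ho⟩
    rw [hh b hb]
    split_ifs with hba
    · rw [hba, hg1]
    · exact hg0 b hb hba
  choose h hval horth using hex
  have hsum : ∀ (f : 𝓔.Space → ℝ), ∀ b ∈ V, 𝓔.ev (∑ a ∈ V, f a • h a) b = f b := by
    intro f b hb
    rw [ev_sum]
    simp only [ev_smul]
    rw [Finset.sum_eq_single b]
    · rw [hval b hb b hb, if_pos rfl, mul_one]
    · intro a ha hab
      rw [hval a ha b hb, if_neg hab.symm, mul_zero]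
    · exact fun hb' => absurd hb hb'
  -- The sum of all `h b` equals 1 on `V`, so it differs from the constant by a function orthogonal
  -- to `h a`.
  have hrow : ∀ a ∈ V, ∑ b ∈ V, 𝓔.form (h a) (h b) = 0 := by
    intro a _
    have h1 := horth a (∑ b ∈ V, (1 : ℝ) • h b - 𝓔.one) (fun b hb => by
      rw [ev_sub, hsum (fun _ => 1) b hb, ev_one, sub_self])
    rw [map_sub, form_one_right, sub_zero] at h1
    simpa only [one_smul, map_sum] using h1
  -- The Markov property gives the sign: clamping `h a - s • h b` to `[0, 1]` restores the values of
  -- `h a` on `V`, so `h a` has no more energy than `h a - s • h b`. Then `s` tends to 0 in effect,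
  -- through a small explicit choice.
  have hneg : ∀ a ∈ V, ∀ b ∈ V, a ≠ b → 𝓔.form (h a) (h b) ≤ 0 := by
    intro a ha b hb hab
    have key : ∀ s : ℝ, 0 < s → 2 * 𝓔.form (h a) (h b) ≤ s * 𝓔.form (h b) (h b) := by
      intro s hs
      obtain ⟨v, hv, hE⟩ := 𝓔.exists_clamp (h a + (-s) • h b)
      have h1 := 𝓔.form_add_smul (h a) (v - h a) 1
      rw [one_smul, add_sub_cancel, horth a (v - h a) (by
        intro x hx
        rw [ev_sub, hv, ev_add, ev_smul, hval a ha x hx, hval b hb x hx]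
        by_cases hxa : x = a
        · simp [hxa, hab]
        · by_cases hxb : x = b
          · simp [hxb, hab.symm, hs.le]
          · simp [hxa, hxb])] at h1
      rw [form_add_smul] at hE
      have h2 := 𝓔.nonneg (v - h a)
      have h3 : 0 ≤ s * (s * 𝓔.form (h b) (h b) - 2 * 𝓔.form (h a) (h b)) := by linarith
      have := nonneg_of_mul_nonneg_right h3 hs
      linarith
    by_contra hpos
    push Not at hpos
    have hb0 := 𝓔.nonneg (h b)
    have h1 := key (𝓔.form (h a) (h b) / (𝓔.form (h b) (h b) + 1)) (by positivity)
    have h2 : 𝓔.form (h a) (h b) / (𝓔.form (h b) (h b) + 1) * 𝓔.form (h b) (h b)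
        ≤ 𝓔.form (h a) (h b) := by
      rw [div_mul_eq_mul_div, div_le_iff₀ (by linarith)]
      nlinarith
    linarith
  set c : 𝓔.Space → 𝓔.Space → ℝ := fun a b => if a = b then 0 else -𝓔.form (h a) (h b) with hc
  have hquad : ∀ f : 𝓔.Space → ℝ, 𝓔.form (∑ a ∈ V, f a • h a) (∑ a ∈ V, f a • h a)
      = (∑ a ∈ V, ∑ b ∈ V, c a b * (f a - f b) ^ 2) / 2 := by
    intro f
    have h1 := sum_sum_mul_sub_sq V (fun a b => 𝓔.form (h a) (h b)) f (fun a b => 𝓔.symm _ _)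
      (fun a ha => by rw [hrow a ha, mul_zero])
    have h2 : ∑ a ∈ V, ∑ b ∈ V, c a b * (f a - f b) ^ 2
        = -∑ a ∈ V, ∑ b ∈ V, 𝓔.form (h a) (h b) * (f a - f b) ^ 2 := by
      simp only [← Finset.sum_neg_distrib]
      refine Finset.sum_congr rfl fun a _ => Finset.sum_congr rfl fun b _ => ?_
      by_cases hab : a = b
      · simp [hab]
      · simp [hc, hab]
    rw [form_sum_smul, h2, h1]; ring
  refine ⟨c, fun a ha b hb => ?_, fun u => ?_, fun f => ⟨_, hsum f, hquad f⟩⟩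
  · by_cases hab : a = b
    · simp [hc, hab]
    · simpa [hc, hab] using hneg a ha b hb hab
  · rw [← hquad]
    -- The minimizer with the values of `u` on `V`; it is orthogonal to `u - w`, which vanishes
    -- there.
    set w := ∑ a ∈ V, 𝓔.ev u a • h a with hw
    have h1 := 𝓔.form_add_smul w (u - w) 1
    have h2 : 𝓔.form w (u - w) = 0 := by
      have : ∀ a ∈ V, 𝓔.form (h a) (u - w) = 0 := fun a _ => horth a _ fun b hb => by
        rw [ev_sub, hsum _ b hb, sub_self]
      conv_lhs => rw [hw]
      simp only [map_sum, LinearMap.sum_apply, map_smul, LinearMap.smul_apply]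
      exact Finset.sum_eq_zero fun a ha => by rw [← hw, this a ha, smul_zero]
    rw [one_smul, add_sub_cancel, h2] at h1
    have := 𝓔.nonneg (u - w)
    linarith

end ResistanceForm

/-- Every ball of radius `ρ` is covered by a bounded number of sets of diameter at most `lρ`. -/
def MetricallyDoubling (Y : Type*) [MetricSpace Y] : Prop :=
  ∀ l : ℝ, 0 < l → ∃ N : ℕ, ∀ (x : Y) (ρ : ℝ), 0 < ρ → ∃ D : Fin N → Set Y,
    Metric.closedBall x ρ ⊆ ⋃ i, D i ∧ ∀ i, ∀ y ∈ D i, ∀ z ∈ D i, dist y z ≤ l * ρ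

/-! ### Cutoff functions and a local Poincaré inequality under metric doubling. -/

namespace ResistanceForm

variable {X : Type*} (𝓔 : ResistanceForm X)

/-- A separator of `x` from a point `y` with `dist x y ≥ s` has energy at most `2 / s`, hence stays
above 1/2 on a small set around `y`. Boundedly many such sets cover the annulus. -/
theorem exists_annulus_separator (hD : MetricallyDoubling 𝓔.Space) : ∃ N : ℕ,
    ∀ (x : 𝓔.Space) (s : ℝ), 0 < s → ∃ g : 𝓔.dom, 𝓔.ev g x = 0 ∧ (∀ z, 0 ≤ 𝓔.ev g z) ∧
      (∀ z, s ≤ dist x z → dist x z ≤ 4 * s → 1 / 2 ≤ 𝓔.ev g z) ∧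
      𝓔.enorm₂ g ≤ N * √(2 / s) := by
  classical
  -- The pieces have diameter at most `s / 8`, so on each one the squared oscillation is at most `(s
  -- / 8) * (2 / s) = 1 / 4`.
  obtain ⟨N, hN⟩ := hD (1 / 32) (by norm_num)
  refine ⟨N, fun x s hs => ?_⟩
  obtain ⟨D, hcov, hdiam⟩ := hN x (4 * s) (by positivity)
  have hex : ∀ i, ∃ g : 𝓔.dom, 𝓔.ev g x = 0 ∧ (∀ z, 0 ≤ 𝓔.ev g z) ∧
      (∀ z ∈ D i, s ≤ dist x z → 1 / 2 ≤ 𝓔.ev g z) ∧ 𝓔.enorm₂ g ≤ √(2 / s) := by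
    intro i
    by_cases hi : ∃ y ∈ D i, s ≤ dist x y
    · obtain ⟨y, hy, hxy⟩ := hi
      have hne : x ≠ y := by
        rintro rfl
        rw [dist_self] at hxy
        linarith
      obtain ⟨g, h01, h0, h1, hE⟩ := 𝓔.exists_separator hne
      have hE' : 𝓔.form g g ≤ 2 / s := hE.trans (by gcongr)
      refine ⟨g, h0, fun z => (h01 z).1, fun z hz _ => ?_, Real.sqrt_le_sqrt hE'⟩
      have h2 := 𝓔.ev_sub_sq_le g y z
      have h3 : dist y z * 𝓔.form g g ≤ (1 / 32 * (4 * s)) * (2 / s) :=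
        mul_le_mul (hdiam i y hy z hz) hE' (𝓔.nonneg g) (by positivity)
      have h4 : (1 / 32 * (4 * s)) * (2 / s) = (1 / 2) ^ 2 := by field_simp; norm_num
      rw [h4] at h3
      have h5 := abs_le_of_sq_le_sq (h2.trans h3) (by norm_num)
      rw [h1] at h5
      have := (abs_le.1 h5).2
      linarith
    · push Not at hi
      exact ⟨0, by simp, by simp, fun z hz h => absurd h (not_le.2 (hi z hz)), by
        rw [enorm₂_zero]; positivity⟩
  choose g hg0 hgn hgD hgE using hex
  refine ⟨∑ i, g i, by simp [hg0], fun z => ?_, fun z h1 h2 => ?_, ?_⟩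
  · rw [ev_sum]
    exact Finset.sum_nonneg fun i _ => hgn i z
  · obtain ⟨i, hi⟩ := Set.mem_iUnion.1 (hcov (by
      rw [Metric.mem_closedBall, dist_comm]; exact h2 : z ∈ Metric.closedBall x (4 * s)))
    rw [ev_sum]
    exact (hgD i z hi h1).trans
      (Finset.single_le_sum (f := fun i => 𝓔.ev (g i) z) (fun i _ => hgn i z) (Finset.mem_univ i))
  · refine (𝓔.enorm₂_sum_le _ _).trans ?_
    refine (Finset.sum_le_sum fun i _ => hgE i).trans ?_
    simp

/-- Cutoff functions at points, with energy at most the inverse of the scale. -/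
theorem exists_point_cutoff (hD : MetricallyDoubling 𝓔.Space) : ∃ δ : ℝ, 0 < δ ∧ ∃ C : ℝ, 0 < C ∧
    ∀ (x : 𝓔.Space) (s : ℝ), 0 < s → ∃ u : 𝓔.dom, (∀ z, 0 ≤ 𝓔.ev u z ∧ 𝓔.ev u z ≤ 1) ∧
      (∀ z, dist x z ≤ δ * s → 𝓔.ev u z = 1) ∧ (∀ z, s ≤ dist x z → 𝓔.ev u z = 0) ∧
      𝓔.form u u ≤ C / s := by
  obtain ⟨N, hN⟩ := 𝓔.exists_annulus_separator hD
  set B : ℝ := 2 * (N * √2) + 1 with hB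
  have hBpos : 0 < B := by positivity
  refine ⟨1 / (16 * B ^ 2), by positivity, 16 * B ^ 2, by positivity, fun x s hs => ?_⟩
  -- The annuli with radii from `4 ^ j * s` to `4 ^ (j + 1) * s` exhaust the complement of the ball
  -- of radius `s`, and the seminorms of their separators decay like `2 ^ (-j)`.
  choose g hg0 hgn hgA hgE using fun j : ℕ => hN x (4 ^ j * s) (by positivity)
  obtain ⟨G, hG0, hGg, hGE⟩ := 𝓔.exists_ge_of_geometric g x (N * √(2 / s)) (1 / 2) (by norm_num)
    (by norm_num) hg0 hgn (fun j => by
      refine (hgE j).trans (le_of_eq ?_)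
      rw [mul_assoc]
      congr 1
      have h4 : (2 : ℝ) / (4 ^ j * s) = 2 / s * ((1 / 2) ^ j) ^ 2 := by
        rw [← pow_mul, mul_comm j 2, pow_mul]
        norm_num
        rw [one_div, inv_pow]
        field_simp
      rw [h4, Real.sqrt_mul (by positivity), Real.sqrt_sq (by positivity)])
  have hGE' : 𝓔.form G G ≤ B ^ 2 / s := by
    rw [← enorm₂_sq]
    have h1 : 𝓔.enorm₂ G ≤ B / √s := by
      refine hGE.trans ?_
      rw [Real.sqrt_div (by norm_num), hB]
      have : (N : ℝ) * (√2 / √s) / (1 - 1 / 2) = (2 * (N * √2)) / √s := by ring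
      rw [this]
      gcongr
      linarith
    calc 𝓔.enorm₂ G ^ 2 ≤ (B / √s) ^ 2 := by gcongr; exact 𝓔.enorm₂_nonneg _
      _ = B ^ 2 / s := by rw [div_pow, Real.sq_sqrt hs.le]
  have hGfar : ∀ z, s ≤ dist x z → 1 / 2 ≤ 𝓔.ev G z := by
    intro z hz
    have h1 : 1 ≤ dist x z / s := (one_le_div hs).2 hz
    obtain ⟨j, hj1, hj2⟩ := exists_nat_pow_near h1 (by norm_num : (1 : ℝ) < 4)
    rw [le_div_iff₀ hs] at hj1
    rw [div_lt_iff₀ hs, pow_succ] at hj2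
    exact (hgA j z hj1 (by linarith)).trans (hGg j z)
  have hGnear : ∀ z, dist x z ≤ 1 / (16 * B ^ 2) * s → 𝓔.ev G z ≤ 1 / 4 := by
    intro z hz
    have h1 := 𝓔.ev_sub_sq_le G z x
    rw [hG0, sub_zero, dist_comm] at h1
    have h2 : dist x z * 𝓔.form G G ≤ 1 / (16 * B ^ 2) * s * (B ^ 2 / s) :=
      mul_le_mul hz hGE' (𝓔.nonneg G) (by positivity)
    have h3 : 1 / (16 * B ^ 2) * s * (B ^ 2 / s) = (1 / 4) ^ 2 := by field_simp; norm_num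
    rw [h3] at h2
    exact (abs_le.1 (abs_le_of_sq_le_sq (h1.trans h2) (by norm_num))).2
  -- The map `t ↦ 2 - 4 t` takes `G ≤ 1/4` to values at least 1 and `G ≥ 1/2` to values at most 0.
  obtain ⟨v, hv, hE⟩ := 𝓔.exists_clamp ((-4 : ℝ) • G + (2 : ℝ) • 𝓔.one)
  rw [form_shift, form_smul_smul] at hE
  have hv' : ∀ z, 𝓔.ev v z = max 0 (min 1 (-4 * 𝓔.ev G z + 2)) := by
    intro z; rw [hv]; simp
  refine ⟨v, fun z => ?_, fun z hz => ?_, fun z hz => ?_, ?_⟩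
  · rw [hv']
    exact ⟨le_max_left _ _, max_le zero_le_one (min_le_left _ _)⟩
  · have := hGnear z hz
    rw [hv', min_eq_left (by linarith), max_eq_right zero_le_one]
  · have := hGfar z hz
    rw [hv']
    exact max_eq_left ((min_le_right _ _).trans (by linarith))
  · calc 𝓔.form v v ≤ (-4) ^ 2 * 𝓔.form G G := hE
      _ ≤ (-4) ^ 2 * (B ^ 2 / s) := by gcongr
      _ = 16 * B ^ 2 / s := by ring

/-- Cutoff functions at sets of diameter comparable to the scale. -/
theorem exists_cutoff (hD : MetricallyDoubling 𝓔.Space) (B : ℝ) (hB : 0 < B) :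
    ∃ C : ℝ, 0 < C ∧ ∀ (x : 𝓔.Space) (s : ℝ) (Q : Set 𝓔.Space), 0 < s →
      (∀ q ∈ Q, dist x q ≤ B * s) → ∃ u : 𝓔.dom, (∀ z, 0 ≤ 𝓔.ev u z ∧ 𝓔.ev u z ≤ 1) ∧
        (∀ z ∈ Q, 𝓔.ev u z = 1) ∧ (∀ z, (∀ q ∈ Q, s ≤ dist q z) → 𝓔.ev u z = 0) ∧
        𝓔.form u u ≤ C / s := by
  classical
  obtain ⟨δ, hδ, C, hC, hcut⟩ := 𝓔.exists_point_cutoff hD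
  -- Pieces of a ball of radius `B * s` then have diameter at most `δ * s`, so a point cutoff at one
  -- point of a piece is 1 on the whole piece.
  obtain ⟨N, hN⟩ := hD (δ / B) (by positivity)
  refine ⟨(N : ℝ) ^ 2 * C + 1, by positivity, fun x s Q hs hQ => ?_⟩
  obtain ⟨D, hcov, hdiam⟩ := hN x (B * s) (by positivity)
  have hex : ∀ i, ∃ u : 𝓔.dom, (∀ z, 0 ≤ 𝓔.ev u z) ∧ (∀ z ∈ Q ∩ D i, 𝓔.ev u z = 1) ∧
      (∀ z, (∀ q ∈ Q, s ≤ dist q z) → 𝓔.ev u z = 0) ∧ 𝓔.form u u ≤ C / s := by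
    intro i
    by_cases hi : (Q ∩ D i).Nonempty
    · obtain ⟨y, hyQ, hyD⟩ := hi
      obtain ⟨u, h1, h2, h3, h4⟩ := hcut y s hs
      refine ⟨u, fun z => (h1 z).1, fun z hz => h2 z ?_, fun z hz => h3 z (hz y hyQ), h4⟩
      have := hdiam i y hyD z hz.2
      have h5 : δ / B * (B * s) = δ * s := by field_simp
      rwa [h5] at this
    · exact ⟨0, by simp, fun z hz => absurd ⟨z, hz⟩ hi, by simp, by simp; positivity⟩
  choose u h0 h1 h2 hE using hex
  obtain ⟨v, hv, hvE⟩ := 𝓔.exists_clamp (∑ i, u i)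
  refine ⟨v, fun z => ?_, fun z hz => ?_, fun z hz => ?_, ?_⟩
  · rw [hv]
    exact ⟨le_max_left _ _, max_le zero_le_one (min_le_left _ _)⟩
  · obtain ⟨i, hi⟩ := Set.mem_iUnion.1 (hcov (by
      rw [Metric.mem_closedBall, dist_comm]; exact hQ z hz : z ∈ Metric.closedBall x (B * s)))
    have h3 : 1 ≤ ∑ i, 𝓔.ev (u i) z := by
      rw [← h1 i z ⟨hz, hi⟩]
      exact Finset.single_le_sum (f := fun i => 𝓔.ev (u i) z) (fun i _ => h0 i z)
        (Finset.mem_univ i)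
    rw [hv, ev_sum, min_eq_left h3, max_eq_right zero_le_one]
  · rw [hv, ev_sum, Finset.sum_eq_zero fun i _ => h2 i z hz]
    simp
  · refine hvE.trans ((𝓔.form_sum_le Finset.univ u (by positivity)
      (Finset.card_fin N).le fun i _ => hE i).trans ?_)
    rw [← mul_div_assoc]
    gcongr
    linarith

theorem abs_clamp_sub_le (p q : ℝ) :
    |max 0 (min 1 p) - max 0 (min 1 q)| ≤ |p - q| := by
  refine (abs_max_sub_max_le_max _ _ _ _).trans ?_
  rw [sub_self, abs_zero]
  refine max_le (abs_nonneg _) ((abs_min_sub_min_le_max _ _ _ _).trans ?_)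
  rw [sub_self, abs_zero]
  exact max_le (abs_nonneg _) le_rfl

/-- A local Poincaré inequality for the traces on finite sets. -/
theorem exists_local_poincare (hD : MetricallyDoubling 𝓔.Space) (C₀ : ℝ) (hC₀ : 0 < C₀) :
    ∃ A : ℝ, 0 < A ∧ ∀ (r : ℝ), 0 < r → ∀ (V : Finset 𝓔.Space) (c : 𝓔.Space → 𝓔.Space → ℝ),
      (∀ a ∈ V, ∀ b ∈ V, 0 ≤ c a b) →
      (∀ u : 𝓔.dom, (∑ a ∈ V, ∑ b ∈ V, c a b * (𝓔.ev u a - 𝓔.ev u b) ^ 2) / 2 ≤ 𝓔.form u u) →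
      (∀ f : 𝓔.Space → ℝ, ∃ u : 𝓔.dom, (∀ a ∈ V, 𝓔.ev u a = f a) ∧
        𝓔.form u u = (∑ a ∈ V, ∑ b ∈ V, c a b * (f a - f b) ^ 2) / 2) →
      ∀ f : 𝓔.Space → ℝ, ∀ x ∈ V, ∀ y ∈ V, dist x y ≤ C₀ * r →
        (f x - f y) ^ 2 ≤ 2 * C₀ * r * ∑ a ∈ V, ∑ b ∈ V,
          if dist x a ≤ A * r then c a b * (f a - f b) ^ 2 else 0 := by
  classical
  obtain ⟨C, hC, hcut⟩ := 𝓔.exists_cutoff hD 1 one_pos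
  -- Chosen so that the cutoff of scale `s₁ * r` contributes exactly 1/2 in `h1` below and can be
  -- absorbed.
  set s₁ : ℝ := 4 * C * C₀ with hs₁
  have hs₁pos : 0 < s₁ := by positivity
  refine ⟨s₁, by positivity, fun r hr V c hc htr hext f x hx y hy hxy => ?_⟩
  set loc := ∑ a ∈ V, ∑ b ∈ V, if dist x a ≤ s₁ * r then c a b * (f a - f b) ^ 2 else 0
    with hloc
  have hloc0 : 0 ≤ loc := by
    refine Finset.sum_nonneg fun a ha => Finset.sum_nonneg fun b hb => ?_
    split_ifs
    · exact mul_nonneg (hc a ha b hb) (sq_nonneg _)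
    · exact le_rfl
  rcases eq_or_ne (f x) (f y) with hfxy | hfxy
  · rw [hfxy, sub_self]
    have : 0 ≤ 2 * C₀ * r * loc := by positivity
    simpa using this
  set d := f x - f y with hd
  have hd0 : d ≠ 0 := sub_ne_zero.2 hfxy
  obtain ⟨ψ, hψ01, hψ1, hψ0, hψE⟩ := hcut x (s₁ * r) {x} (by positivity) (by
    rintro q rfl; rw [dist_self]; positivity)
  set g : 𝓔.Space → ℝ := fun a => max 0 (min 1 ((f a - f y) / d)) with hg
  have hg01 : ∀ a, 0 ≤ g a ∧ g a ≤ 1 := fun a =>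
    ⟨le_max_left _ _, max_le zero_le_one (min_le_left _ _)⟩
  have hgx : g x = 1 := by simp [hg, ← hd, div_self hd0]
  have hgy : g y = 0 := by simp [hg]
  have hglip : ∀ a b, (g a - g b) ^ 2 ≤ (f a - f b) ^ 2 / d ^ 2 := by
    intro a b
    have h1 := sq_le_sq.2 (abs_clamp_sub_le ((f a - f y) / d) ((f b - f y) / d))
    rwa [← sub_div, div_pow, sub_sub_sub_cancel_right] at h1
  -- The product is formed only on `V` and extended with the energy of the network. Since `u x = 1`
  -- and `u y = 0`, the energy of `u` is at least `1 / (C₀ * r)`.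
  obtain ⟨u, hu, huE⟩ := hext fun a => 𝓔.ev ψ a * g a
  have hlow : 1 ≤ C₀ * r * 𝓔.form u u := by
    have h1 := 𝓔.ev_sub_sq_le u x y
    rw [hu x hx, hu y hy, hgx, hgy, hψ1 x rfl] at h1
    have h2 : dist x y * 𝓔.form u u ≤ C₀ * r * 𝓔.form u u :=
      mul_le_mul_of_nonneg_right hxy (𝓔.nonneg u)
    linarith
  have hterm : ∀ a ∈ V, ∀ b ∈ V, c a b * (𝓔.ev ψ a * g a - 𝓔.ev ψ b * g b) ^ 2
      ≤ 2 * (c a b * (𝓔.ev ψ a - 𝓔.ev ψ b) ^ 2)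
        + 2 / d ^ 2 * (if dist x a ≤ s₁ * r then c a b * (f a - f b) ^ 2 else 0) := by
    intro a ha b hb
    have hcab := hc a ha b hb
    obtain ⟨hψa0, hψa1⟩ := hψ01 a
    obtain ⟨hgb0, hgb1⟩ := hg01 b
    have hexp : (𝓔.ev ψ a * g a - 𝓔.ev ψ b * g b) ^ 2
        ≤ 2 * (𝓔.ev ψ a - 𝓔.ev ψ b) ^ 2 + 2 * (𝓔.ev ψ a ^ 2 * (g a - g b) ^ 2) := by
      -- The asymmetric product rule puts `ψ a` in front of the difference of `g`, so only the
      -- starting point `a` of a conductance has to be near `x`; `b` may be anywhere.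
      have h1 : 𝓔.ev ψ a * g a - 𝓔.ev ψ b * g b
          = g b * (𝓔.ev ψ a - 𝓔.ev ψ b) + 𝓔.ev ψ a * (g a - g b) := by ring
      rw [h1]
      refine (add_sq_le).trans ?_
      rw [mul_pow, mul_pow, mul_add]
      have : g b ^ 2 * (𝓔.ev ψ a - 𝓔.ev ψ b) ^ 2 ≤ 1 * (𝓔.ev ψ a - 𝓔.ev ψ b) ^ 2 := by
        gcongr
        exact pow_le_one₀ hgb0 hgb1
      linarith
    have hloc1 : 𝓔.ev ψ a ^ 2 * (c a b * (g a - g b) ^ 2)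
        ≤ 1 / d ^ 2 * (if dist x a ≤ s₁ * r then c a b * (f a - f b) ^ 2 else 0) := by
      split_ifs with hxa
      · calc 𝓔.ev ψ a ^ 2 * (c a b * (g a - g b) ^ 2)
            ≤ 1 * (c a b * ((f a - f b) ^ 2 / d ^ 2)) := by
              gcongr
              · exact pow_le_one₀ hψa0 hψa1
              · exact hglip a b
          _ = 1 / d ^ 2 * (c a b * (f a - f b) ^ 2) := by ring
      · rw [hψ0 a (by rintro q rfl; exact (not_le.1 hxa).le)]
        simp
    have h2 := mul_le_mul_of_nonneg_left hexp hcab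
    calc c a b * (𝓔.ev ψ a * g a - 𝓔.ev ψ b * g b) ^ 2
        ≤ 2 * (c a b * (𝓔.ev ψ a - 𝓔.ev ψ b) ^ 2)
          + 2 * (𝓔.ev ψ a ^ 2 * (c a b * (g a - g b) ^ 2)) := by linarith
      _ ≤ 2 * (c a b * (𝓔.ev ψ a - 𝓔.ev ψ b) ^ 2) + 2 * (1 / d ^ 2 *
          (if dist x a ≤ s₁ * r then c a b * (f a - f b) ^ 2 else 0)) := by gcongr
      _ = _ := by ring
  have hsum : 𝓔.form u u ≤ 2 * 𝓔.form ψ ψ + loc / d ^ 2 := by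
    have h1 := Finset.sum_le_sum fun a ha => Finset.sum_le_sum fun b hb => hterm a ha b hb
    simp only [Finset.sum_add_distrib, ← Finset.mul_sum] at h1
    rw [← hloc] at h1
    have h2 := htr ψ
    have h3 : 2 / d ^ 2 * loc = 2 * (loc / d ^ 2) := by ring
    rw [h3] at h1
    rw [huE]
    linarith
  have h1 : C₀ * r * (2 * 𝓔.form ψ ψ) ≤ 1 / 2 := by
    calc C₀ * r * (2 * 𝓔.form ψ ψ) ≤ C₀ * r * (2 * (C / (s₁ * r))) := by gcongr
      _ = 1 / 2 := by rw [hs₁]; field_simp; norm_num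
  have h2 : C₀ * r * 𝓔.form u u ≤ C₀ * r * (2 * 𝓔.form ψ ψ + loc / d ^ 2) := by gcongr
  have h3 : 1 / 2 ≤ C₀ * r * loc / d ^ 2 := by
    rw [mul_div_assoc]
    linarith
  rw [le_div_iff₀ (by positivity)] at h3
  linarith

end ResistanceForm

/-! ### Levels of the tree, the cell graph and partitions. -/

namespace RefTree

variable {T : Type*} (𝒯 : RefTree T)

/-- Without periodic points `n - m` is determined by `w`: two relations with different values would
make some `π^[p] φ` periodic. The minima in `b w φ` and `b φ w` are therefore attained by the same
pair. -/
theorem level_of_iterate_eq (hper : ¬ {w : T | ∃ n ≥ 1, 𝒯.π^[n] w = w}.Nonempty) {w : T} {n m : ℕ}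
    (h : 𝒯.π^[n] w = 𝒯.π^[m] 𝒯.φ) : 𝒯.level w = (n : ℤ) - m := by
  have hinj : ∀ p q : ℕ, 𝒯.π^[p] 𝒯.φ = 𝒯.π^[q] 𝒯.φ → q ≤ p := by
    intro p q hpq
    by_contra hlt
    push Not at hlt
    refine hper ⟨𝒯.π^[p] 𝒯.φ, q - p, by omega, ?_⟩
    rw [← Function.iterate_add_apply, Nat.sub_add_cancel hlt.le, hpq]
  have huniq : ∀ n m n' m' : ℕ, 𝒯.π^[n] w = 𝒯.π^[m] 𝒯.φ → 𝒯.π^[n'] w = 𝒯.π^[m'] 𝒯.φ →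
      n + m' = n' + m := by
    intro n m n' m' h h'
    have h1 : 𝒯.π^[n + m'] 𝒯.φ = 𝒯.π^[n' + m] 𝒯.φ := by
      rw [Function.iterate_add_apply, ← h', Function.iterate_add_apply, ← h,
        ← Function.iterate_add_apply, ← Function.iterate_add_apply, add_comm]
    exact le_antisymm (hinj _ _ h1.symm) (hinj _ _ h1)
  obtain ⟨m₀, h0⟩ : ∃ m, 𝒯.π^[𝒯.b w 𝒯.φ] w = 𝒯.π^[m] 𝒯.φ :=
    Nat.sInf_mem (s := {n : ℕ | ∃ m : ℕ, 𝒯.π^[n] w = 𝒯.π^[m] 𝒯.φ}) ⟨n, m, h⟩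
  obtain ⟨n₁, h1⟩ : ∃ m, 𝒯.π^[𝒯.b 𝒯.φ w] 𝒯.φ = 𝒯.π^[m] w :=
    Nat.sInf_mem (s := {n : ℕ | ∃ m : ℕ, 𝒯.π^[n] 𝒯.φ = 𝒯.π^[m] w}) ⟨m, n, h.symm⟩
  have h2 : 𝒯.b w 𝒯.φ ≤ n₁ := Nat.sInf_le ⟨_, h1.symm⟩
  have h3 : 𝒯.b 𝒯.φ w ≤ m₀ := Nat.sInf_le ⟨_, h0.symm⟩
  have h4 := huniq _ _ _ _ h0 h1.symm
  have h5 := huniq _ _ _ _ h0 h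
  rw [level]
  omega

/-- Either `φ` is the root and all levels are nonnegative, or `π` lowers all levels by one. -/
theorem level_π_cases :
    (𝒯.π 𝒯.φ = 𝒯.φ ∧ ∀ w, (w = 𝒯.φ ∧ 𝒯.level w = 0) ∨
      (0 < 𝒯.level w ∧ 𝒯.level (𝒯.π w) = 𝒯.level w - 1)) ∨
    ∀ w, 𝒯.level (𝒯.π w) = 𝒯.level w - 1 := by
  by_cases hper : {w : T | ∃ n ≥ 1, 𝒯.π^[n] w = w}.Nonempty
  · left
    obtain ⟨n, hn, hφ⟩ := 𝒯.φ_periodic hper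
    have hroot : 𝒯.π 𝒯.φ = 𝒯.φ := 𝒯.periodic_subsingleton
      ⟨n, hn, by rw [← Function.iterate_succ_apply, Function.iterate_succ_apply', hφ]⟩ ⟨n, hn, hφ⟩
    have hfix : ∀ m, 𝒯.π^[m] 𝒯.φ = 𝒯.φ := Function.iterate_fixed hroot
    have hreach : ∀ w, ∃ n, 𝒯.π^[n] w = 𝒯.φ := by
      intro w
      obtain ⟨n, m, h⟩ := 𝒯.common_ancestor w 𝒯.φ
      exact ⟨n, by rw [h, hfix]⟩
    have hlevel : ∀ w, 𝒯.level w = (sInf {n : ℕ | 𝒯.π^[n] w = 𝒯.φ} : ℕ) := by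
      intro w
      have h1 : 𝒯.b 𝒯.φ w = 0 := by
        obtain ⟨n, hn⟩ := hreach w
        exact Nat.sInf_eq_zero.2 (Or.inl ⟨n, by simp [hn]⟩)
      rw [level, h1, b]
      simp [hfix]
    refine ⟨hroot, fun w => ?_⟩
    by_cases hw : w = 𝒯.φ
    · left
      refine ⟨hw, ?_⟩
      rw [hlevel, hw]
      simp
    · right
      have h1 : 𝒯.π^[sInf {n : ℕ | 𝒯.π^[n] w = 𝒯.φ}] w = 𝒯.φ := Nat.sInf_mem (hreach w)
      have h2 : 𝒯.π^[sInf {n : ℕ | 𝒯.π^[n] (𝒯.π w) = 𝒯.φ}] (𝒯.π w) = 𝒯.φ :=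
        Nat.sInf_mem (hreach (𝒯.π w))
      have h3 : sInf {n : ℕ | 𝒯.π^[n] w = 𝒯.φ} ≤ sInf {n : ℕ | 𝒯.π^[n] (𝒯.π w) = 𝒯.φ} + 1 :=
        Nat.sInf_le (by rw [← Function.iterate_succ_apply] at h2; exact h2)
      rw [hlevel, hlevel]
      rcases h : sInf {n : ℕ | 𝒯.π^[n] w = 𝒯.φ} with _ | k
      · rw [h] at h1
        exact absurd h1 hw
      · rw [h] at h1 h3
        have h4 : sInf {n : ℕ | 𝒯.π^[n] (𝒯.π w) = 𝒯.φ} ≤ k :=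
          Nat.sInf_le (by rw [Function.iterate_succ_apply] at h1; exact h1)
        omega
  · right
    intro w
    obtain ⟨n, m, h⟩ := 𝒯.common_ancestor w 𝒯.φ
    have h1 : 𝒯.π^[n] (𝒯.π w) = 𝒯.π^[m + 1] 𝒯.φ := by
      rw [← Function.iterate_succ_apply, Function.iterate_succ_apply', Function.iterate_succ_apply',
        h]
    rw [𝒯.level_of_iterate_eq hper h, 𝒯.level_of_iterate_eq hper h1]
    push_cast
    ring

theorem level_π_congr {a b : T} (h : 𝒯.level a = 𝒯.level b) :
    𝒯.level (𝒯.π a) = 𝒯.level (𝒯.π b) := by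
  rcases 𝒯.level_π_cases with ⟨hφ, hw⟩ | hw
  · rcases hw a with ⟨rfl, ha⟩ | ⟨ha, ha'⟩ <;> rcases hw b with ⟨hb1, hb⟩ | ⟨hb, hb'⟩
    · rw [hb1]
    · omega
    · omega
    · omega
  · rw [hw, hw, h]

/-- The element `w` of level at most `n` serves to exclude `n < 0` when there is a root, since `π`
fixes the root and levels stop decreasing there. -/
theorem level_iterate {w : T} {n : ℤ} (hn : 𝒯.level w ≤ n) (k : ℕ) {v : T}
    (hv : 𝒯.level v = n + k) : 𝒯.level (𝒯.π^[k] v) = n := by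
  induction k generalizing v with
  | zero => simpa using hv
  | succ k ih =>
    rw [Function.iterate_succ_apply]
    apply ih
    rcases 𝒯.level_π_cases with ⟨hφ, h⟩ | h
    · have hw : 0 ≤ 𝒯.level w := by
        rcases h w with ⟨-, h0⟩ | ⟨h0, -⟩ <;> omega
      rcases h v with ⟨-, h1⟩ | ⟨-, h1⟩
      · push_cast at hv; omega
      · push_cast at hv; omega
    · rw [h v]; push_cast at hv; omega

theorem mem_descendants_iterate {w v : T} {k : ℕ} (hv : 𝒯.level v = 𝒯.level w + k) :
    v ∈ 𝒯.descendants (𝒯.π^[k] v) k :=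
  ⟨rfl, by rw [𝒯.level_iterate le_rfl k hv, hv]⟩

theorem descendants_zero_self (w : T) : w ∈ 𝒯.descendants w 0 := ⟨rfl, by simp⟩

theorem descendants_trans {w v u : T} {k l : ℕ} (hv : v ∈ 𝒯.descendants w k)
    (hu : u ∈ 𝒯.descendants v l) : u ∈ 𝒯.descendants w (k + l) := by
  refine ⟨?_, ?_⟩
  · rw [Function.iterate_add_apply, hu.1, hv.1]
  · rw [hu.2, hv.2]; push_cast; ring

variable {Y : Type*} (K : T → Set Y)

theorem edist_le_one_of_adj_or_eq {a b : T} (h : a = b ∨ (𝒯.cellGraph K).Adj a b) :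
    (𝒯.cellGraph K).edist a b ≤ 1 := by
  rcases h with rfl | h
  · simp
  · exact (SimpleGraph.edist_eq_one_iff_adj.2 h).le

theorem exists_step_of_edist_le {a b : T} {m : ℕ}
    (h : (𝒯.cellGraph K).edist a b ≤ (m + 1 : ℕ)) :
    ∃ c, (a = c ∨ (𝒯.cellGraph K).Adj a c) ∧ (𝒯.cellGraph K).edist c b ≤ m := by
  obtain ⟨p, hp⟩ := SimpleGraph.exists_walk_of_edist_ne_top
    (ne_top_of_le_ne_top (ENat.natCast_ne_top _) h)
  rw [← hp] at h
  cases p with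
  | nil => exact ⟨a, Or.inl rfl, by simp⟩
  | @cons _ c _ hac q =>
    refine ⟨c, Or.inr hac, (SimpleGraph.edist_le q).trans ?_⟩
    rw [SimpleGraph.Walk.length_cons] at h
    have h1 : q.length + 1 ≤ m + 1 := by exact_mod_cast h
    exact_mod_cast Nat.le_of_succ_le_succ h1

theorem eq_of_edist_le_zero {a b : T} (h : (𝒯.cellGraph K).edist a b ≤ (0 : ℕ)) : a = b :=
  SimpleGraph.edist_eq_zero_iff.1 (le_antisymm (by exact_mod_cast h) zero_le)

theorem level_eq_of_edist_le {a b : T} {m : ℕ} (h : (𝒯.cellGraph K).edist a b ≤ m) :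
    𝒯.level a = 𝒯.level b := by
  induction m generalizing a with
  | zero => rw [𝒯.eq_of_edist_le_zero K h]
  | succ m ih =>
    obtain ⟨c, hac, hcb⟩ := 𝒯.exists_step_of_edist_le K h
    rw [← ih hcb]
    rcases hac with rfl | hac
    · rfl
    · exact hac.1

theorem edist_le_add {a b c : T} {m n : ℕ} (h : (𝒯.cellGraph K).edist a b ≤ m)
    (h' : (𝒯.cellGraph K).edist b c ≤ n) : (𝒯.cellGraph K).edist a c ≤ (m + n : ℕ) :=
  SimpleGraph.edist_triangle.trans (by push_cast; exact add_le_add h h')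

theorem edist_le_one_of_mem {a b : T} {x : Y} (hl : 𝒯.level a = 𝒯.level b) (ha : x ∈ K a)
    (hb : x ∈ K b) : (𝒯.cellGraph K).edist a b ≤ (1 : ℕ) := by
  refine 𝒯.edist_le_one_of_adj_or_eq K ?_
  by_cases h : a = b
  · exact Or.inl h
  · exact Or.inr ⟨hl, ⟨x, ha, hb⟩, h⟩

/-- A finite set containing the ball of radius `m`, of size bounded in terms of `m`. -/
theorem exists_finset_ball (h : ∃ L : ℕ, ∀ w, {v | (𝒯.cellGraph K).Adj w v}.encard ≤ L) (m : ℕ) :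
    ∃ N : ℕ, ∀ w, ∃ s : Finset T, s.card ≤ N ∧
      ∀ v, (𝒯.cellGraph K).edist w v ≤ m → v ∈ s := by
  classical
  obtain ⟨L, hL⟩ := h
  induction m with
  | zero =>
    refine ⟨1, fun w => ⟨{w}, by simp, fun v hv => ?_⟩⟩
    simp [𝒯.eq_of_edist_le_zero K hv]
  | succ m ih =>
    obtain ⟨N, hN⟩ := ih
    choose s hs hmem using hN
    refine ⟨(L + 1) * N, fun w => ?_⟩
    have hfin := Set.finite_of_encard_le_coe (hL w)
    have hcard : hfin.toFinset.card ≤ L := by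
      have := hL w
      rw [hfin.encard_eq_coe_toFinset_card] at this
      exact_mod_cast this
    refine ⟨(insert w hfin.toFinset).biUnion s, ?_, fun v hv => ?_⟩
    · refine (Finset.card_biUnion_le_card_mul _ _ N fun c _ => hs c).trans ?_
      gcongr
      exact (Finset.card_insert_le _ _).trans (by omega)
    · obtain ⟨c, hc, hcv⟩ := 𝒯.exists_step_of_edist_le K hv
      refine Finset.mem_biUnion.2 ⟨c, ?_, hmem c v hcv⟩
      rcases hc with rfl | hc
      · simp
      · exact Finset.mem_insert_of_mem (by simpa using hc)

theorem exists_finset_descendants (h : ∃ N : ℕ, ∀ w, (𝒯.descendants w 1).encard ≤ N) (k : ℕ) :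
    ∃ N : ℕ, ∀ w, ∃ s : Finset T, s.card ≤ N ∧ ∀ v ∈ 𝒯.descendants w k, v ∈ s := by
  classical
  obtain ⟨L, hL⟩ := h
  induction k with
  | zero =>
    refine ⟨1, fun w => ⟨{w}, by simp, fun v hv => ?_⟩⟩
    have : v = w := hv.1
    simp [this]
  | succ k ih =>
    obtain ⟨N, hN⟩ := ih
    choose s hs hmem using hN
    refine ⟨N * L, fun w => ?_⟩
    have hfin := fun u => Set.finite_of_encard_le_coe (hL u)
    have hcard : ∀ u, (hfin u).toFinset.card ≤ L := by
      intro u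
      have := hL u
      rw [(hfin u).encard_eq_coe_toFinset_card] at this
      exact_mod_cast this
    refine ⟨(s w).biUnion fun u => (hfin u).toFinset, ?_, fun v hv => ?_⟩
    · refine (Finset.card_biUnion_le_card_mul _ _ L fun c _ => hcard c).trans ?_
      gcongr
      exact hs w
    · have h1 : 𝒯.level (𝒯.π v) = 𝒯.level w + k := by
        have := 𝒯.level_iterate (w := w) (n := 𝒯.level w + k) (by omega) 1 (v := v) (by
          rw [hv.2]; push_cast; ring)
        simpa using this
      refine Finset.mem_biUnion.2 ⟨𝒯.π v, hmem w _ ⟨?_, h1⟩, ?_⟩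
      · rw [← Function.iterate_succ_apply]; exact hv.1
      · simp only [Set.Finite.mem_toFinset]
        refine ⟨rfl, ?_⟩
        rw [h1, hv.2]; push_cast; ring

namespace IsPartition

variable {𝒯 K} [MetricSpace Y] (hK : 𝒯.IsPartition K)
include hK

theorem exists_mem_descendants {w : T} {x : Y} (hx : x ∈ K w) (k : ℕ) :
    ∃ v ∈ 𝒯.descendants w k, x ∈ K v := by
  induction k with
  | zero => exact ⟨w, 𝒯.descendants_zero_self w, hx⟩
  | succ k ih =>
    obtain ⟨v, hv, hxv⟩ := ih
    rw [← hK.subdivision v] at hxv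
    obtain ⟨u, hu, hxu⟩ := Set.mem_iUnion₂.1 hxv
    exact ⟨u, 𝒯.descendants_trans hv hu, hxu⟩

theorem subset_parent (a : T) : K a ⊆ K (𝒯.π a) := by
  have h1 : 𝒯.level (𝒯.π a) = 𝒯.level a - 1 → K a ⊆ K (𝒯.π a) := by
    intro h
    conv_rhs => rw [← hK.subdivision (𝒯.π a)]
    exact Set.subset_biUnion_of_mem (u := K) (show a ∈ 𝒯.descendants (𝒯.π a) 1 from
      ⟨rfl, by rw [h]; push_cast; ring⟩)
  rcases 𝒯.level_π_cases with ⟨hφ, h⟩ | h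
  · rcases h a with ⟨rfl, -⟩ | ⟨-, h2⟩
    · rw [hφ]
    · exact h1 h2
  · exact h1 (h a)

theorem subset_iterate (a : T) (k : ℕ) : K a ⊆ K (𝒯.π^[k] a) := by
  induction k with
  | zero => rfl
  | succ k ih =>
    rw [Function.iterate_succ_apply']
    exact ih.trans (hK.subset_parent _)

theorem exists_mem_level (w : T) (x : Y) : ∃ v, 𝒯.level v = 𝒯.level w ∧ x ∈ K v := by
  have h0 : x ∈ ⋃ w ∈ {w | 𝒯.level w = 0}, K w := by rw [hK.cover]; trivial
  obtain ⟨a, ha, hxa⟩ := Set.mem_iUnion₂.1 h0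
  have ha0 : 𝒯.level a = 0 := ha
  rcases le_total 0 (𝒯.level w) with h | h
  · obtain ⟨k, hk⟩ := Int.eq_ofNat_of_zero_le h
    obtain ⟨v, hv, hxv⟩ := hK.exists_mem_descendants hxa k
    exact ⟨v, by rw [hv.2, ha0, hk]; simp, hxv⟩
  · obtain ⟨k, hk⟩ := Int.eq_ofNat_of_zero_le (neg_nonneg.2 h)
    refine ⟨𝒯.π^[k] a, 𝒯.level_iterate le_rfl k (by omega), hK.subset_iterate a k hxa⟩

/-- Cells are contained in their parents, so a chain of intersecting cells is mapped by `π` to a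
chain of intersecting or equal cells of one level. -/
theorem edist_parent_le {a b : T} {m : ℕ} (h : (𝒯.cellGraph K).edist a b ≤ m) :
    (𝒯.cellGraph K).edist (𝒯.π a) (𝒯.π b) ≤ m := by
  induction m generalizing a with
  | zero => rw [𝒯.eq_of_edist_le_zero K h]; simp
  | succ m ih =>
    obtain ⟨c, hac, hcb⟩ := 𝒯.exists_step_of_edist_le K h
    have h1 : (𝒯.cellGraph K).edist (𝒯.π a) (𝒯.π c) ≤ (1 : ℕ) := by
      rcases hac with rfl | hac
      · simp
      · obtain ⟨x, hxa, hxc⟩ := hac.2.1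
        exact 𝒯.edist_le_one_of_mem K (𝒯.level_π_congr hac.1) (hK.subset_parent a hxa)
          (hK.subset_parent c hxc)
    rw [add_comm]
    exact 𝒯.edist_le_add K h1 (ih hcb)

theorem edist_iterate_le {a b : T} {m : ℕ} (h : (𝒯.cellGraph K).edist a b ≤ m) (k : ℕ) :
    (𝒯.cellGraph K).edist (𝒯.π^[k] a) (𝒯.π^[k] b) ≤ m := by
  induction k with
  | zero => exact h
  | succ k ih =>
    rw [Function.iterate_succ_apply', Function.iterate_succ_apply']
    exact hK.edist_parent_le ih

end IsPartition

end RefTree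

/-! ### Geometry of the cells and the doubling property. -/

namespace RefTree.IsBasicFramework

variable {T : Type*} {𝒯 : RefTree T} {Y : Type*} [MetricSpace Y] {K : T → Set Y} {ζ : ℝ} {M : ℕ}
  (hK : 𝒯.IsBasicFramework K ζ M)
include hK

theorem exists_dist_le : ∃ C > 0, ∀ w, ∀ x ∈ K w, ∀ y ∈ K w, dist x y ≤ C * ζ ^ 𝒯.level w := by
  obtain ⟨_, -, C, hC, h⟩ := hK.diam_comparable
  exact ⟨C, hC, fun w x hx y hy =>
    (Metric.dist_le_diam_of_mem (hK.isCompact w).isBounded hx hy).trans (h w).2⟩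

theorem exists_dist_le_of_edist_le : ∃ C > 0, ∀ (m : ℕ) (w v : T),
    (𝒯.cellGraph K).edist w v ≤ m → ∀ x ∈ K w, ∀ y ∈ K v,
      dist x y ≤ (m + 1) * (C * ζ ^ 𝒯.level w) := by
  obtain ⟨C, hC, h⟩ := hK.exists_dist_le
  refine ⟨C, hC, fun m => ?_⟩
  induction m with
  | zero =>
    intro w v hwv x hx y hy
    rw [← 𝒯.eq_of_edist_le_zero K hwv] at hy
    simpa using h w x hx y hy
  | succ m ih =>
    intro w v hwv x hx y hy
    obtain ⟨c, hc, hcv⟩ := 𝒯.exists_step_of_edist_le K hwv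
    push_cast
    rcases hc with rfl | hc
    · have h1 := ih w v hcv x hx y hy
      have h2 : 0 ≤ C * ζ ^ 𝒯.level w := dist_nonneg.trans (h w x hx x hx)
      linarith
    · obtain ⟨z, hzw, hzc⟩ := hc.2.1
      have h1 := ih c v hcv z hzc y hy
      have h2 := h w x hx z hzw
      rw [← hc.1] at h1
      have h3 := dist_triangle x z y
      linarith

/-- If `dist x y` is small compared with `ζ ^ [w]`, then `Δ_M(x, y) > [w]`. So `x` and `y` are
linked at some finer level, and ancestors of the linking cells do so at level `[w]`. -/
theorem exists_link : ∃ c > 0, ∀ (w : T) (x y : Y), dist x y < c * ζ ^ 𝒯.level w →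
    ∃ a b, 𝒯.level a = 𝒯.level w ∧ 𝒯.level b = 𝒯.level w ∧ x ∈ K a ∧ y ∈ K b ∧
      (𝒯.cellGraph K).edist a b ≤ M := by
  obtain ⟨c, hc, _, -, h⟩ := hK.dist_comparable
  refine ⟨c, hc, fun w x y hxy => ?_⟩
  rcases eq_or_ne x y with rfl | hne
  · obtain ⟨a, ha, hxa⟩ := hK.exists_mem_level w x
    exact ⟨a, a, ha, ha, hxa, hxa, by simp⟩
  · obtain ⟨m, hm, h1, -⟩ := h x y hne
    have h2 : ζ ^ m < ζ ^ 𝒯.level w := lt_of_mul_lt_mul_left (h1.trans_lt hxy) hc.le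
    have h3 : 𝒯.level w < m := (zpow_lt_zpow_iff_right_of_lt_one₀ hK.scale_pos hK.scale_lt_one).1 h2
    obtain ⟨n, ⟨a, b, ha, hb, hxa, hyb, hab⟩, hn⟩ := (lt_isLUB_iff hm).1 h3
    obtain ⟨k, hk⟩ := Int.eq_ofNat_of_zero_le (sub_nonneg.2 hn.le)
    exact ⟨𝒯.π^[k] a, 𝒯.π^[k] b, 𝒯.level_iterate le_rfl k (by omega),
      𝒯.level_iterate le_rfl k (by omega), hK.subset_iterate a k hxa, hK.subset_iterate b k hyb,
      hK.edist_iterate_le hab k⟩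

theorem zpow_pos (n : ℤ) : 0 < ζ ^ n := _root_.zpow_pos hK.scale_pos n

theorem exists_descendant_diam_lt {w : T} {x : Y} (hx : x ∈ K w) {ε : ℝ} (hε : 0 < ε) :
    ∃ k, ∃ v ∈ 𝒯.descendants w k, x ∈ K v ∧ ∀ y ∈ K v, dist x y < ε := by
  obtain ⟨C, hC, h⟩ := hK.exists_dist_le
  have hw := hK.zpow_pos (𝒯.level w)
  obtain ⟨k, hk⟩ := exists_pow_lt_of_lt_one (show 0 < ε / (C * ζ ^ 𝒯.level w) by positivity)
    hK.scale_lt_one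
  obtain ⟨v, hv, hxv⟩ := hK.exists_mem_descendants hx k
  refine ⟨k, v, hv, hxv, fun y hy => (h v x hxv y hy).trans_lt ?_⟩
  rw [lt_div_iff₀ (by positivity)] at hk
  rw [hv.2, zpow_add₀ hK.scale_pos.ne', zpow_natCast]
  linarith

/-- A cell does not meet the interior of another cell of the same level. -/
theorem inter_interior {w v : T} (hl : 𝒯.level w = 𝒯.level v) (hne : w ≠ v) :
    K v ∩ interior (K w) = ∅ := by
  by_contra hcon
  obtain ⟨z, hzv, hzw⟩ := Set.nonempty_iff_ne_empty.2 hcon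
  obtain ⟨ε, hε, hball⟩ := Metric.isOpen_iff.1 isOpen_interior z hzw
  -- A small descendant of `v` at `z` contains a ball and lies in the interior of `K w`; the center
  -- of this ball is then interior to both cells.
  obtain ⟨k, u, hu, hzu, hdiam⟩ := hK.exists_descendant_diam_lt hzv hε
  obtain ⟨ξ, hξ, hc⟩ := hK.contains_ball
  obtain ⟨x, hxu, hxb⟩ := hc u
  have huv : K u ⊆ K v := by
    rw [← hu.1]; exact hK.subset_iterate u k
  have h1 : x ∈ interior (K v) := by
    refine mem_interior.2 ⟨_, hxb.trans huv, Metric.isOpen_ball, Metric.mem_ball_self ?_⟩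
    exact mul_pos hξ (hK.zpow_pos _)
  have h2 : x ∈ interior (K w) := hball (by
    rw [Metric.mem_ball, dist_comm]; exact hdiam x hxu)
  have h3 : x ∈ interior (K w) ∩ interior (K v) := ⟨h2, h1⟩
  rw [hK.disjoint_interiors w v hl hne] at h3
  exact h3

theorem exists_centers : ∃ ξ > 0, ∃ p : T → Y, (∀ w, p w ∈ K w) ∧ (∀ w, p w ∈ interior (K w)) ∧
    ∀ w v, 𝒯.level w = 𝒯.level v → w ≠ v → ∀ y ∈ K v, ξ * ζ ^ 𝒯.level w ≤ dist (p w) y := by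
  obtain ⟨ξ, hξ, hc⟩ := hK.contains_ball
  choose p hp hb using hc
  have hint : ∀ w, Metric.ball (p w) (ξ * ζ ^ 𝒯.level w) ⊆ interior (K w) := fun w =>
    interior_maximal (hb w) Metric.isOpen_ball
  refine ⟨ξ, hξ, p, hp, fun w => hint w (Metric.mem_ball_self (mul_pos hξ (hK.zpow_pos _))),
    fun w v hl hne y hy => ?_⟩
  by_contra hlt
  push Not at hlt
  have h1 : y ∈ K v ∩ interior (K w) := ⟨hy, hint w (by rwa [Metric.mem_ball, dist_comm])⟩
  rw [hK.inter_interior hl hne] at h1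
  exact h1

/-- By `exists_link` such a ball lies in the cells within `1 + M` steps of a cell of level `n` that
contains `x`. A tree with a root has no cells of negative level; then the root cell covers
everything, which is why the levels are only bounded below by `n`. -/
theorem exists_ball_cover : ∃ c > 0, ∃ N : ℕ, ∀ (n : ℤ) (x : Y), ∃ s : Finset T, s.card ≤ N ∧
    (∀ a ∈ s, n ≤ 𝒯.level a) ∧ ∀ y, dist x y < c * ζ ^ n → ∃ a ∈ s, y ∈ K a := by
  classical
  obtain ⟨c, hc, hlink⟩ := hK.exists_link
  obtain ⟨N, hN⟩ := 𝒯.exists_finset_ball K hK.bounded_degree (1 + M)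
  refine ⟨c, hc, N + 1, fun n x => ?_⟩
  by_cases hn : ∃ w, 𝒯.level w = n
  · obtain ⟨w₀, rfl⟩ := hn
    obtain ⟨w, hw, hxw⟩ := hK.exists_mem_level w₀ x
    obtain ⟨s, hs, hmem⟩ := hN w
    refine ⟨s.filter fun a => 𝒯.level a = 𝒯.level w₀,
      (Finset.card_filter_le _ _).trans (hs.trans (Nat.le_succ N)),
      fun a ha => (Finset.mem_filter.1 ha).2.ge, fun y hy => ?_⟩
    obtain ⟨a, b, ha, hb, hxa, hyb, hab⟩ := hlink w₀ x y hy
    exact ⟨b, Finset.mem_filter.2 ⟨hmem b (𝒯.edist_le_add K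
      (𝒯.edist_le_one_of_mem K (hw.trans ha.symm) hxw hxa) hab), hb⟩, hyb⟩
  · have hx0 : ∀ y : Y, ∃ a, 𝒯.level a = 0 ∧ y ∈ K a := by
      intro y
      have h0 : y ∈ ⋃ w ∈ {w | 𝒯.level w = 0}, K w := by rw [hK.cover]; trivial
      obtain ⟨a, ha, hya⟩ := Set.mem_iUnion₂.1 h0
      exact ⟨a, ha, hya⟩
    obtain ⟨a, ha, hxa⟩ := hx0 x
    have hneg : n < 0 := by
      by_contra hpos
      obtain ⟨k, hk⟩ := Int.eq_ofNat_of_zero_le (not_lt.1 hpos)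
      obtain ⟨v, hv, -⟩ := hK.exists_mem_descendants hxa k
      exact hn ⟨v, by rw [hv.2, ha, hk]; simp⟩
    rcases 𝒯.level_π_cases with ⟨hφ, h⟩ | h
    · refine ⟨{𝒯.φ}, by simp, fun b hb => ?_, fun y _ => ⟨𝒯.φ, by simp, ?_⟩⟩
      · rw [Finset.mem_singleton.1 hb]
        rcases h 𝒯.φ with ⟨-, h0⟩ | ⟨h0, -⟩ <;> omega
      · obtain ⟨b, hb, hyb⟩ := hx0 y
        rcases h b with ⟨rfl, -⟩ | ⟨h0, -⟩
        · exact hyb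
        · omega
    · exfalso
      have hit : ∀ k : ℕ, 𝒯.level (𝒯.π^[k] a) = -k := by
        intro k
        induction k with
        | zero => simpa using ha
        | succ k ih =>
          rw [Function.iterate_succ_apply', h, ih]
          push_cast; ring
      obtain ⟨k, hk⟩ := Int.eq_ofNat_of_zero_le (neg_nonneg.2 hneg.le)
      exact hn ⟨𝒯.π^[k] a, by rw [hit]; omega⟩

/-- A ball of radius comparable to `ζ ^ n` is covered by boundedly many cells of level at least `n`;
descending `j` generations, with `j` depending only on `l`, makes them small enough. -/
theorem metricallyDoubling : MetricallyDoubling Y := by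
  classical
  intro l hl
  have hζ := hK.scale_pos
  obtain ⟨c, hc, N₁, hcov⟩ := hK.exists_ball_cover
  obtain ⟨C, hC, hdiam⟩ := hK.exists_dist_le
  obtain ⟨j, hj⟩ := exists_pow_lt_of_lt_one (show 0 < l * c * ζ / C by positivity)
    hK.scale_lt_one
  obtain ⟨N₂, hdesc⟩ := 𝒯.exists_finset_descendants hK.bounded_branching j
  choose d hd hdmem using hdesc
  refine ⟨N₁ * N₂, fun x ρ hρ => ?_⟩
  -- Selects the scale: `c * ζ ^ (n + 1) ≤ ρ < c * ζ ^ n` for `n = -(m + 1)`.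
  obtain ⟨m, hm1, hm2⟩ := exists_mem_Ico_zpow (show 0 < ρ / c by positivity)
    ((one_lt_inv₀ hζ).2 hK.scale_lt_one)
  set n : ℤ := -(m + 1) with hn
  have hlow : c * (ζ * ζ ^ n) ≤ ρ := by
    have : ζ * ζ ^ n = ζ⁻¹ ^ m := by
      rw [inv_zpow', ← zpow_one_add₀ hζ.ne']
      congr 1; omega
    rw [this]
    rwa [le_div_iff₀ hc, mul_comm] at hm1
  have hup : ρ < c * ζ ^ n := by
    have : ζ ^ n = ζ⁻¹ ^ (m + 1) := by rw [inv_zpow']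
    rw [this]
    rwa [div_lt_iff₀ hc, mul_comm] at hm2
  obtain ⟨s, hs, hslev, hscov⟩ := hcov n x
  set S : Finset T := s.biUnion fun a => (d a).filter fun v => v ∈ 𝒯.descendants a j with hS
  have hScard : S.card ≤ N₁ * N₂ := by
    refine (Finset.card_biUnion_le_card_mul _ _ N₂ fun a _ =>
      (Finset.card_filter_le _ _).trans (hd a)).trans ?_
    gcongr
  refine ⟨fun i => {y | ∃ h : i.1 < S.card, y ∈ K (S.equivFin.symm ⟨i, h⟩)}, fun y hy => ?_,
    fun i y hy z hz => ?_⟩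
  · rw [Metric.mem_closedBall, dist_comm] at hy
    obtain ⟨a, ha, hya⟩ := hscov y (hy.trans_lt hup)
    obtain ⟨v, hv, hyv⟩ := hK.exists_mem_descendants hya j
    have hvS : v ∈ S := Finset.mem_biUnion.2 ⟨a, ha, Finset.mem_filter.2 ⟨hdmem a v hv, hv⟩⟩
    refine Set.mem_iUnion.2 ⟨⟨S.equivFin ⟨v, hvS⟩, (Fin.is_lt _).trans_le hScard⟩,
      (S.equivFin ⟨v, hvS⟩).is_lt, ?_⟩
    simpa using hyv
  · obtain ⟨h, hy⟩ := hy
    obtain ⟨h', hz⟩ := hz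
    set v := S.equivFin.symm ⟨i, h⟩ with hv
    obtain ⟨a, ha, hva⟩ := Finset.mem_biUnion.1 v.2
    have hlev := (Finset.mem_filter.1 hva).2.2
    have h1 : ζ ^ 𝒯.level v.1 ≤ ζ ^ (n + j) := by
      refine zpow_le_zpow_right_of_le_one₀ hζ hK.scale_lt_one.le ?_
      have := hslev a ha
      omega
    rw [zpow_add₀ hζ.ne', zpow_natCast] at h1
    have hzn := hK.zpow_pos n
    have h2 : C * ζ ^ j ≤ l * c * ζ := by
      rw [lt_div_iff₀ hC] at hj
      linarith
    calc dist y z ≤ C * ζ ^ 𝒯.level v.1 := hdiam v.1 y hy z hz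
      _ ≤ C * (ζ ^ n * ζ ^ j) := by gcongr
      _ = (C * ζ ^ j) * ζ ^ n := by ring
      _ ≤ (l * c * ζ) * ζ ^ n := by gcongr
      _ = l * (c * (ζ * ζ ^ n)) := by ring
      _ ≤ l * ρ := by gcongr

/-- The number of centers of cells of a given level in a ball of comparable radius. -/
theorem exists_card_le {ξ : ℝ} (hξ : 0 < ξ) {p : T → Y} (hp : ∀ w, p w ∈ K w)
    (hsep : ∀ w v, 𝒯.level w = 𝒯.level v → w ≠ v → ∀ y ∈ K v, ξ * ζ ^ 𝒯.level w ≤ dist (p w) y)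
    (B : ℝ) (hB : 0 < B) : ∃ N : ℕ, ∀ (n : ℤ) (x : Y) (s : Finset T),
      (∀ v ∈ s, 𝒯.level v = n ∧ dist x (p v) ≤ B * ζ ^ n) → s.card ≤ N := by
  classical
  obtain ⟨N, hN⟩ := hK.metricallyDoubling (ξ / (2 * B)) (by positivity)
  refine ⟨N, fun n x s hs => ?_⟩
  have hn := hK.zpow_pos n
  obtain ⟨D, hcov, hdiam⟩ := hN x (B * ζ ^ n) (by positivity)
  have hex : ∀ v ∈ s, ∃ i, p v ∈ D i := fun v hv => Set.mem_iUnion.1 (hcov (by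
    rw [Metric.mem_closedBall, dist_comm]; exact (hs v hv).2))
  choose i hi using hex
  have hinj : Function.Injective fun v : s => i v.1 v.2 := by
    rintro ⟨v, hv⟩ ⟨w, hw⟩ hvw
    by_contra hne
    have hne' : v ≠ w := fun h => hne (Subtype.ext h)
    have h1 := hsep v w ((hs v hv).1.trans (hs w hw).1.symm) hne' _ (hp w)
    have hvw' : i v hv = i w hw := hvw
    have h2 := hdiam _ _ (hi v hv) _ (hvw' ▸ hi w hw)
    have h3 : ξ / (2 * B) * (B * ζ ^ n) = ξ * ζ ^ n / 2 := by field_simp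
    rw [(hs v hv).1] at h1
    have h4 : 0 < ξ * ζ ^ n := by positivity
    linarith
  simpa using Fintype.card_le_of_injective _ hinj

end RefTree.IsBasicFramework

/-! ### Sampling at centers and the upper bound. -/

namespace RefTree.IsBasicFramework

variable {X : Type*} {𝓔 : ResistanceForm X} {T : Type*} {𝒯 : RefTree T} {K : T → Set 𝓔.Space}
  {ζ : ℝ} {M : ℕ} (hK : 𝒯.IsBasicFramework K ζ M)
include hK

/-- Sampling at the centers of the cells does not increase the energy by more than a factor. -/
theorem exists_discreteEnergy_le {ξ : ℝ} (hξ : 0 < ξ) {p : T → 𝓔.Space} (hp : ∀ w, p w ∈ K w)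
    (hsep : ∀ w v, 𝒯.level w = 𝒯.level v → w ≠ v → ∀ y ∈ K v,
      ξ * ζ ^ 𝒯.level w ≤ dist (p w) y) :
    ∃ C : ℝ, 0 < C ∧ ∀ (n : ℤ) (u : 𝓔.dom),
      𝒯.discreteEnergy K n (fun v => 𝓔.ev u (p v)) ≤ ENNReal.ofReal (C * ζ ^ n * 𝓔.form u u) := by
  classical
  obtain ⟨C₁, hC₁, hdist⟩ := hK.exists_dist_le_of_edist_le
  obtain ⟨A, hA, hLP⟩ := 𝓔.exists_local_poincare hK.metricallyDoubling (2 * C₁) (by positivity)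
  obtain ⟨N, hN⟩ := hK.exists_card_le hξ hp hsep A hA
  obtain ⟨L, hL⟩ := hK.bounded_degree
  refine ⟨2 * (2 * C₁) * (L * N) * 2 + 1, by positivity, fun n u => ?_⟩
  have hn := hK.zpow_pos n
  have hE := 𝓔.nonneg u
  refine ENNReal.half_le_self.trans ?_
  rw [ENNReal.tsum_eq_iSup_sum]
  refine iSup_le fun F => ?_
  rw [← ENNReal.ofReal_sum_of_nonneg fun _ _ => sq_nonneg _]
  refine ENNReal.ofReal_le_ofReal ?_
  rcases F.eq_empty_or_nonempty with rfl | ⟨e₀, he₀⟩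
  · rw [Finset.sum_empty]; positivity
  -- The trace is taken on the end points of finitely many edges. The constants below do not depend
  -- on `F`, so the bound passes to the full sum.
  set V : Finset 𝓔.Space := F.image (fun e => p e.1.1) ∪ F.image (fun e => p e.1.2) with hV
  have hV1 : ∀ e ∈ F, p e.1.1 ∈ V := fun e he =>
    Finset.mem_union_left _ (Finset.mem_image_of_mem _ he)
  have hV2 : ∀ e ∈ F, p e.1.2 ∈ V := fun e he =>
    Finset.mem_union_right _ (Finset.mem_image_of_mem _ he)
  obtain ⟨c, hc0, hctr, hcext⟩ := 𝓔.exists_trace V ⟨_, hV1 e₀ he₀⟩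
  set t : 𝓔.Space → 𝓔.Space → ℝ := fun a b => c a b * (𝓔.ev u a - 𝓔.ev u b) ^ 2 with ht
  have ht0 : ∀ a ∈ V, ∀ b ∈ V, 0 ≤ t a b := fun a ha b hb =>
    mul_nonneg (hc0 a ha b hb) (sq_nonneg _)
  have hedge : ∀ e ∈ F, (𝓔.ev u (p e.1.1) - 𝓔.ev u (p e.1.2)) ^ 2 ≤ 2 * (2 * C₁) * ζ ^ n *
      ∑ a ∈ V, ∑ b ∈ V, if dist (p e.1.1) a ≤ A * ζ ^ n then t a b else 0 := by
    intro e he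
    refine hLP (ζ ^ n) hn V c hc0 hctr hcext (𝓔.ev u) _ (hV1 e he) _ (hV2 e he) ?_
    have h1 := hdist 1 e.1.1 e.1.2 (by
      exact_mod_cast (SimpleGraph.edist_eq_one_iff_adj.2 e.2.2).le) _ (hp _) _ (hp _)
    rw [e.2.1] at h1
    push_cast at h1
    linarith
  -- Bounded overlap: boundedly many centers of level `n` lie within `A * ζ ^ n` of `a`, and each
  -- starts at most `L` edges.
  have hcount : ∀ a, ((F.filter fun e => dist (p e.1.1) a ≤ A * ζ ^ n).card : ℝ) ≤ L * N := by
    intro a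
    set F' := F.filter fun e => dist (p e.1.1) a ≤ A * ζ ^ n with hF'
    have h1 : (F'.image fun e => e.1.1).card ≤ N := by
      refine hN n a _ fun v hv => ?_
      obtain ⟨e, he, rfl⟩ := Finset.mem_image.1 hv
      exact ⟨e.2.1, by rw [dist_comm]; exact (Finset.mem_filter.1 he).2⟩
    have h2 : F'.card ≤ L * (F'.image fun e => e.1.1).card := by
      refine Finset.card_le_mul_card_image _ L fun v _ => ?_
      have h3 : ((F'.filter fun e => e.1.1 = v).image fun e => e.1.2).card
          = (F'.filter fun e => e.1.1 = v).card := by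
        refine Finset.card_image_of_injOn fun e he e' he' h => ?_
        have h4 := (Finset.mem_filter.1 he).2
        have h5 := (Finset.mem_filter.1 he').2
        exact Subtype.ext (Prod.ext (h4.trans h5.symm) h)
      rw [← h3]
      have h6 : ((((F'.filter fun e => e.1.1 = v).image fun e => e.1.2 : Finset T) : Set T)).encard
          ≤ L := by
        refine (Set.encard_le_encard ?_).trans (hL v)
        intro b hb
        obtain ⟨e, he, rfl⟩ := Finset.mem_image.1 (Finset.mem_coe.1 hb)
        have h4 := (Finset.mem_filter.1 he).2
        rw [← h4]
        exact e.2.2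
      rw [Set.encard_coe_eq_coe_finsetCard] at h6
      exact_mod_cast h6
    have h3 : F'.card ≤ L * N := h2.trans (by gcongr)
    exact_mod_cast h3
  have hover : ∑ e ∈ F, ∑ a ∈ V, ∑ b ∈ V, (if dist (p e.1.1) a ≤ A * ζ ^ n then t a b else 0)
      ≤ L * N * (2 * 𝓔.form u u) := by
    rw [Finset.sum_comm]
    have h1 : ∀ a ∈ V, ∑ e ∈ F, ∑ b ∈ V, (if dist (p e.1.1) a ≤ A * ζ ^ n then t a b else 0)
        ≤ L * N * ∑ b ∈ V, t a b := by
      intro a ha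
      rw [Finset.sum_comm, Finset.mul_sum]
      refine Finset.sum_le_sum fun b hb => ?_
      rw [← Finset.sum_filter, Finset.sum_const, nsmul_eq_mul]
      exact mul_le_mul_of_nonneg_right (hcount a) (ht0 a ha b hb)
    refine (Finset.sum_le_sum h1).trans ?_
    rw [← Finset.mul_sum]
    have h2 := hctr u
    refine mul_le_mul_of_nonneg_left ?_ (by positivity)
    linarith
  calc ∑ e ∈ F, (𝓔.ev u (p e.1.1) - 𝓔.ev u (p e.1.2)) ^ 2
      ≤ 2 * (2 * C₁) * ζ ^ n * ∑ e ∈ F, ∑ a ∈ V, ∑ b ∈ V,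
          (if dist (p e.1.1) a ≤ A * ζ ^ n then t a b else 0) := by
        rw [Finset.mul_sum]
        exact Finset.sum_le_sum hedge
    _ ≤ 2 * (2 * C₁) * ζ ^ n * (L * N * (2 * 𝓔.form u u)) := by gcongr
    _ = (2 * (2 * C₁) * (L * N) * 2) * ζ ^ n * 𝓔.form u u := by ring
    _ ≤ (2 * (2 * C₁) * (L * N) * 2 + 1) * ζ ^ n * 𝓔.form u u := by
        gcongr
        linarith

/-- The competitor is a cutoff around the centers of the descendants of `w`, at scale `c * ζ ^ [w]`,
sampled at all centers of level `[w] + k`. -/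
theorem exists_energy₂_le : ∃ C : ℝ, 0 < C ∧ ∀ (w : T) (k : ℕ),
    𝒯.energy₂ K M k w ≤ ENNReal.ofReal (C * ζ ^ k) := by
  obtain ⟨ξ, hξ, p, hp, hint, hsep⟩ := hK.exists_centers
  obtain ⟨C₁, hC₁, hdisc⟩ := hK.exists_discreteEnergy_le hξ hp hsep
  obtain ⟨C₂, hC₂, hdiam⟩ := hK.exists_dist_le
  obtain ⟨c, hc, hlink⟩ := hK.exists_link
  obtain ⟨C₃, hC₃, hcut⟩ := 𝓔.exists_cutoff hK.metricallyDoubling (C₂ / c) (by positivity)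
  refine ⟨C₁ * (C₃ / c), by positivity, fun w k => ?_⟩
  have hw := hK.zpow_pos (𝒯.level w)
  have hsub : ∀ v ∈ 𝒯.descendants w k, K v ⊆ K w := by
    intro v hv
    have := hK.subset_iterate v k
    rwa [hv.1] at this
  obtain ⟨u, -, hu1, hu0, huE⟩ := hcut (p w) (c * ζ ^ 𝒯.level w) (p '' 𝒯.descendants w k)
    (by positivity) (by
      rintro _ ⟨v, hv, rfl⟩
      have h1 : C₂ / c * (c * ζ ^ 𝒯.level w) = C₂ * ζ ^ 𝒯.level w := by field_simp
      rw [h1]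
      exact hdiam w _ (hp w) _ (hsub v hv (hp v)))
  refine (iInf₂_le (fun v => 𝓔.ev u (p v)) ⟨fun v hv => hu1 _ ⟨v, hv, rfl⟩, fun v' hv' => ?_⟩).trans
    ((hdisc _ u).trans (ENNReal.ofReal_le_ofReal ?_))
  swap
  · refine hu0 _ ?_
    rintro _ ⟨v, hv, rfl⟩
    by_contra hlt
    push Not at hlt
    obtain ⟨a, b, ha, hb, hva, hvb, hab⟩ := hlink w _ _ hlt
    -- Centers are interior points, so they lie in only one cell of level `[w]`. The cells linking
    -- two nearby centers must therefore be `w` and the `k`-th ancestor of `v'`, which contradicts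
    -- that `v'` is far.
    have huniq : ∀ {x d e}, x ∈ interior (K d) → x ∈ K e → 𝒯.level d = 𝒯.level e → d = e := by
      intro x d e hx hxe hde
      by_contra hne
      have h1 : x ∈ K e ∩ interior (K d) := ⟨hxe, hx⟩
      rw [hK.inter_interior hde hne] at h1
      exact h1
    have h1 : w = a := huniq (interior_mono (hsub v hv) (hint v)) hva ha.symm
    have h2 : 𝒯.π^[k] v' = b := huniq (interior_mono (hK.subset_iterate v' k) (hint v')) hvb
      ((𝒯.level_iterate le_rfl k hv'.1).trans hb.symm)
    have h3 := hv'.2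
    rw [h1, h2] at h3
    exact absurd hab (not_le.2 h3)
  · rw [zpow_add₀ hK.scale_pos.ne', zpow_natCast]
    calc C₁ * (ζ ^ 𝒯.level w * ζ ^ k) * 𝓔.form u u
        ≤ C₁ * (ζ ^ 𝒯.level w * ζ ^ k) * (C₃ / (c * ζ ^ 𝒯.level w)) := by
          have := hK.scale_pos
          gcongr
      _ = C₁ * (C₃ / c) * ζ ^ k := by field_simp

end RefTree.IsBasicFramework

/-! ### Partitions of unity subordinate to the cells. -/

theorem sum_min_one_telescope {ι : Type*} (e : ι → ℕ) (he : Function.Injective e) (g : ι → ℝ)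
    (s : Finset ι) :
    ∑ v ∈ s, (min 1 (∑ i ∈ s with e i ≤ e v, g i) - min 1 (∑ i ∈ s with e i < e v, g i))
      = min 1 (∑ i ∈ s, g i) := by
  classical
  -- In the order given by `e`, each summand is the increment of the truncated partial sum;
  -- appending the largest index leaves the earlier increments unchanged.
  induction s using Finset.induction_on_max_value e with
  | empty => simp
  | insert a s ha hmax ih =>
    have hlt : ∀ x ∈ s, e x < e a := fun x hx =>
      lt_of_le_of_ne (hmax x hx) fun h => ha (he h ▸ hx)
    have h1 : (insert a s).filter (fun i => e i ≤ e a) = insert a s := by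
      refine Finset.filter_true_of_mem fun x hx => ?_
      rcases Finset.mem_insert.1 hx with rfl | hx
      · exact le_rfl
      · exact hmax x hx
    have h2 : (insert a s).filter (fun i => e i < e a) = s := by
      rw [Finset.filter_insert, if_neg (lt_irrefl _)]
      exact Finset.filter_true_of_mem hlt
    have h3 : ∀ v ∈ s, (insert a s).filter (fun i => e i ≤ e v) = s.filter fun i => e i ≤ e v := by
      intro v hv
      rw [Finset.filter_insert, if_neg (not_le.2 (hlt v hv))]
    have h4 : ∀ v ∈ s, (insert a s).filter (fun i => e i < e v) = s.filter fun i => e i < e v := by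
      intro v hv
      rw [Finset.filter_insert, if_neg (not_lt.2 (hlt v hv).le)]
    have h5 : ∑ v ∈ s, (min 1 (∑ i ∈ insert a s with e i ≤ e v, g i)
        - min 1 (∑ i ∈ insert a s with e i < e v, g i)) = min 1 (∑ i ∈ s, g i) := by
      rw [← ih]
      exact Finset.sum_congr rfl fun v hv => by rw [h3 v hv, h4 v hv]
    rw [Finset.sum_insert ha, h1, h2, h5]
    ring

namespace RefTree.IsBasicFramework

variable {X : Type*} {𝓔 : ResistanceForm X} {T : Type*} {𝒯 : RefTree T} {K : T → Set 𝓔.Space}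
  {ζ : ℝ} {M : ℕ} (hK : 𝒯.IsBasicFramework K ζ M)
include hK

theorem exists_edist_le : ∃ c > 0, ∀ v v', 𝒯.level v = 𝒯.level v' → ∀ x ∈ K v, ∀ y ∈ K v',
    dist x y < c * ζ ^ 𝒯.level v → (𝒯.cellGraph K).edist v v' ≤ (M + 2 : ℕ) := by
  obtain ⟨c, hc, hlink⟩ := hK.exists_link
  refine ⟨c, hc, fun v v' hl x hx y hy hxy => ?_⟩
  obtain ⟨a, b, ha, hb, hxa, hyb, hab⟩ := hlink v x y hxy
  have h1 := 𝒯.edist_le_add K (𝒯.edist_le_add K (𝒯.edist_le_one_of_mem K ha.symm hx hxa) hab)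
    (𝒯.edist_le_one_of_mem K (hb.trans hl) hyb hy)
  rwa [show 1 + M + 1 = M + 2 by ring] at h1

/-- Partitions of unity subordinate to neighborhoods of the cells of a level. -/
theorem exists_partition_of_unity {c : ℝ} (hnear : ∀ v v', 𝒯.level v = 𝒯.level v' → ∀ x ∈ K v,
      ∀ y ∈ K v', dist x y < c * ζ ^ 𝒯.level v → (𝒯.cellGraph K).edist v v' ≤ (M + 2 : ℕ))
    {η : ℝ} (hη : 0 < η) (hηc : 2 * η ≤ c) :
    ∃ C : ℝ, 0 < C ∧ ∃ φ : T → 𝓔.dom, (∀ v, 𝓔.form (φ v) (φ v) ≤ C / ζ ^ 𝒯.level v) ∧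
      (∀ v z, 𝓔.ev (φ v) z ≠ 0 → ∃ q ∈ K v, dist q z < η * ζ ^ 𝒯.level v) ∧
      ∀ (w : T) (z : 𝓔.Space) (U : Finset T), (∀ v ∈ U, 𝒯.level v = 𝒯.level w) →
        (∀ v, 𝒯.level v = 𝒯.level w → (∃ q ∈ K v, dist q z < η * ζ ^ 𝒯.level w) → v ∈ U) →
        ∑ v ∈ U, 𝓔.ev (φ v) z = 1 := by
  classical
  obtain ⟨e, he⟩ := @exists_injective_nat T 𝒯.countable
  obtain ⟨N, hN⟩ := 𝒯.exists_finset_ball K hK.bounded_degree (M + 2)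
  choose s hs hsmem using hN
  set near : T → Finset T := fun v =>
    (s v).filter fun i => 𝒯.level i = 𝒯.level v ∧ (𝒯.cellGraph K).edist v i ≤ (M + 2 : ℕ)
    with hneardef
  have hnearcard : ∀ v, (near v).card ≤ N := fun v => (Finset.card_filter_le _ _).trans (hs v)
  obtain ⟨C₂, hC₂, hdiam⟩ := hK.exists_dist_le
  obtain ⟨C₃, hC₃, hcut⟩ := 𝓔.exists_cutoff hK.metricallyDoubling (C₂ / η) (by positivity)
  have hr := fun v => hK.zpow_pos (𝒯.level v)
  have hψ : ∀ v, ∃ u : 𝓔.dom, (∀ z, 0 ≤ 𝓔.ev u z) ∧ (∀ z ∈ K v, 𝓔.ev u z = 1) ∧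
      (∀ z, 𝓔.ev u z ≠ 0 → ∃ q ∈ K v, dist q z < η * ζ ^ 𝒯.level v) ∧
      𝓔.form u u ≤ C₃ / (η * ζ ^ 𝒯.level v) := by
    intro v
    obtain ⟨x, hx⟩ := (hK.nontrivial v).nonempty
    obtain ⟨u, h01, h1, h0, hE⟩ := hcut x (η * ζ ^ 𝒯.level v) (K v)
      (mul_pos hη (hr v)) (fun q hq => by
        have h1 : C₂ / η * (η * ζ ^ 𝒯.level v) = C₂ * ζ ^ 𝒯.level v := by field_simp
        rw [h1]
        exact hdiam v x hx q hq)
    refine ⟨u, fun z => (h01 z).1, h1, fun z hz => ?_, hE⟩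
    by_contra hcon
    push Not at hcon
    exact hz (h0 z hcon)
  choose ψ hψ0 hψ1 hψs hψE using hψ
  choose cl hcl hclE using 𝓔.exists_clamp
  have hclsum : ∀ (F : Finset T) z, 𝓔.ev (cl (∑ i ∈ F, ψ i)) z = min 1 (∑ i ∈ F, 𝓔.ev (ψ i) z) := by
    intro F z
    rw [hcl, 𝓔.ev_sum]
    exact max_eq_right (le_min zero_le_one (Finset.sum_nonneg fun i _ => hψ0 i z))
  have hclen : ∀ (v : T) (F : Finset T), F ⊆ near v →
      𝓔.enorm₂ (cl (∑ i ∈ F, ψ i)) ≤ √((N : ℝ) ^ 2 * (C₃ / (η * ζ ^ 𝒯.level v))) := by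
    intro v F hF
    have := hr v
    refine Real.sqrt_le_sqrt ((hclE _).trans (𝓔.form_sum_le F ψ (by positivity)
      ((Finset.card_le_card hF).trans (hnearcard v)) fun i hi => ?_))
    have h1 := hψE i
    rwa [(Finset.mem_filter.1 (hF hi)).2.1] at h1
  -- Increments of truncated partial sums need only linearity and the Markov property, unlike the
  -- quotients `ψ v / ∑ ψ i`. Restricting the sums to `near v` bounds the energy.
  set φ : T → 𝓔.dom := fun v => cl (∑ i ∈ near v with e i ≤ e v, ψ i)
    - cl (∑ i ∈ near v with e i < e v, ψ i) with hφ
  have hφval : ∀ v z, 𝓔.ev (φ v) z = min 1 (∑ i ∈ near v with e i ≤ e v, 𝓔.ev (ψ i) z)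
      - min 1 (∑ i ∈ near v with e i < e v, 𝓔.ev (ψ i) z) := by
    intro v z
    rw [hφ, 𝓔.ev_sub, hclsum, hclsum]
  have hφ0 : ∀ v z, 𝓔.ev (ψ v) z = 0 → 𝓔.ev (φ v) z = 0 := by
    intro v z hz
    rw [hφval, sub_eq_zero]
    congr 1
    refine Finset.sum_congr_of_eq_on_inter ?_ ?_ fun _ _ _ => rfl
    · intro i hi hi'
      obtain ⟨hin, hile⟩ := Finset.mem_filter.1 hi
      have : ¬ e i < e v := fun h => hi' (Finset.mem_filter.2 ⟨hin, h⟩)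
      have hiv : i = v := he (le_antisymm hile (not_lt.1 this))
      rw [hiv, hz]
    · intro i hi hi'
      obtain ⟨hin, hlt⟩ := Finset.mem_filter.1 hi
      exact absurd (Finset.mem_filter.2 ⟨hin, hlt.le⟩) hi'
  refine ⟨4 * ((N : ℝ) ^ 2 * (C₃ / η)) + 1, by positivity, φ, fun v => ?_, fun v z hz => ?_,
    fun w z U hU hUmem => ?_⟩
  · have hrv := hr v
    have h1 : 𝓔.enorm₂ (φ v) ≤ 2 * √((N : ℝ) ^ 2 * (C₃ / (η * ζ ^ 𝒯.level v))) := by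
      refine (𝓔.enorm₂_sub_le _ _).trans ?_
      have h2 := hclen v _ (Finset.filter_subset (fun i => e i ≤ e v) (near v))
      have h3 := hclen v _ (Finset.filter_subset (fun i => e i < e v) (near v))
      linarith
    rw [← 𝓔.enorm₂_sq]
    calc 𝓔.enorm₂ (φ v) ^ 2 ≤ (2 * √((N : ℝ) ^ 2 * (C₃ / (η * ζ ^ 𝒯.level v)))) ^ 2 := by
          gcongr; exact 𝓔.enorm₂_nonneg _
      _ = 4 * ((N : ℝ) ^ 2 * (C₃ / η)) / ζ ^ 𝒯.level v := by
          rw [mul_pow, Real.sq_sqrt (by positivity)]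
          field_simp
          ring
      _ ≤ _ := by gcongr; linarith
  · exact hψs v z fun h => hz (hφ0 v z h)
  · have hrw := hr w
    set P := U.filter fun v => 𝓔.ev (ψ v) z ≠ 0 with hP
    have hPU : ∀ v, 𝒯.level v = 𝒯.level w → 𝓔.ev (ψ v) z ≠ 0 → v ∈ P := by
      intro v hl hv
      refine Finset.mem_filter.2 ⟨hUmem v hl ?_, hv⟩
      have := hψs v z hv
      rwa [hl] at this
    -- At the point `z` the restriction to `near v` is harmless: if `ψ v` and `ψ i` are both nonzero
    -- at `z`, their cells are less than `2 * η * ζ ^ [w]` apart, hence `i` is in `near v`.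
    have hlocal : ∀ v ∈ P, ∀ (r : ℕ → ℕ → Prop) [DecidableRel r],
        ∑ i ∈ near v with r (e i) (e v), 𝓔.ev (ψ i) z = ∑ i ∈ P with r (e i) (e v), 𝓔.ev (ψ i) z := by
      intro v hv r _
      have hvl := hU v (Finset.mem_filter.1 hv).1
      refine Finset.sum_congr_of_eq_on_inter ?_ ?_ fun _ _ _ => rfl
      · intro i hi hi'
        obtain ⟨hin, hir⟩ := Finset.mem_filter.1 hi
        by_contra hne
        exact hi' (Finset.mem_filter.2 ⟨hPU i ((Finset.mem_filter.1 hin).2.1.trans hvl) hne, hir⟩)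
      · intro i hi hi'
        obtain ⟨hiP, hir⟩ := Finset.mem_filter.1 hi
        refine hi' (Finset.mem_filter.2 ⟨?_, hir⟩) |>.elim
        have hil := hU i (Finset.mem_filter.1 hiP).1
        obtain ⟨q, hq, hqz⟩ := hψs v z (Finset.mem_filter.1 hv).2
        obtain ⟨q', hq', hqz'⟩ := hψs i z (Finset.mem_filter.1 hiP).2
        rw [hvl] at hqz
        rw [hil] at hqz'
        have h1 : (𝒯.cellGraph K).edist v i ≤ (M + 2 : ℕ) := by
          refine hnear v i (hvl.trans hil.symm) q hq q' hq' ?_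
          rw [hvl]
          have h2 := dist_triangle_right q q' z
          have h3 : 2 * η * ζ ^ 𝒯.level w ≤ c * ζ ^ 𝒯.level w := by gcongr
          linarith
        exact Finset.mem_filter.2 ⟨hsmem v i h1, hil.trans hvl.symm, h1⟩
    have h1 : ∑ v ∈ U, 𝓔.ev (φ v) z = ∑ v ∈ P, 𝓔.ev (φ v) z := by
      refine (Finset.sum_filter_of_ne (p := fun v => 𝓔.ev (ψ v) z ≠ 0)
        fun v _ hv h => hv (hφ0 v z h)).symm
    have h2 : ∀ v ∈ P, 𝓔.ev (φ v) z = min 1 (∑ i ∈ P with e i ≤ e v, 𝓔.ev (ψ i) z)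
        - min 1 (∑ i ∈ P with e i < e v, 𝓔.ev (ψ i) z) := by
      intro v hv
      rw [hφval, hlocal v hv (· ≤ ·), hlocal v hv (· < ·)]
    rw [h1, Finset.sum_congr rfl h2, sum_min_one_telescope e he]
    obtain ⟨v, hvl, hzv⟩ := hK.exists_mem_level w z
    refine min_eq_left ?_
    rw [← hψ1 v z hzv]
    exact Finset.single_le_sum (f := fun i => 𝓔.ev (ψ i) z) (fun i _ => hψ0 i z)
      (hPU v hvl (by rw [hψ1 v z hzv]; exact one_ne_zero))

end RefTree.IsBasicFramework

/-! ### Discrete energy and differences over bounded graph distance. -/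

namespace RefTree

variable {T : Type*} (𝒯 : RefTree T)

/-- The squared gradient of `f` at a cell. -/
noncomputable def gradSq {Y : Type*} (K : T → Set Y) (f : T → ℝ) (a : T) : ℝ≥0∞ :=
  ∑' b : {b // (𝒯.cellGraph K).Adj a b}, ENNReal.ofReal ((f a - f b) ^ 2)

theorem tsum_gradSq {Y : Type*} (K : T → Set Y) (n : ℤ) (f : T → ℝ) :
    ∑' a : {a // 𝒯.level a = n}, 𝒯.gradSq K f a = 2 * 𝒯.discreteEnergy K n f := by
  rw [discreteEnergy, ENNReal.mul_div_cancel (by norm_num) (by norm_num)]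
  simp only [gradSq]
  let E : (Σ a : {a // 𝒯.level a = n}, {b // (𝒯.cellGraph K).Adj a.1 b}) ≃
      {e : T × T // 𝒯.level e.1 = n ∧ (𝒯.cellGraph K).Adj e.1 e.2} :=
    { toFun := fun x => ⟨(x.1.1, x.2.1), x.1.2, x.2.2⟩
      invFun := fun e => ⟨⟨e.1.1, e.2.1⟩, ⟨e.1.2, e.2.2⟩⟩
      left_inv := fun _ => rfl
      right_inv := fun _ => rfl }
  exact (ENNReal.tsum_sigma' fun x : Σ a : {a // 𝒯.level a = n}, {b // (𝒯.cellGraph K).Adj a.1 b} =>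
    ENNReal.ofReal ((f x.1.1 - f x.2.1) ^ 2)).symm.trans
    (E.tsum_eq fun e => ENNReal.ofReal ((f e.1.1 - f e.1.2) ^ 2))

/-- Induction along a path from `v` to `v'`: each step splits off one edge difference by `(x + y)² ≤
2x² + 2y²`, and the gradient at its starting cell dominates it. -/
theorem ofReal_sub_sq_le {Y : Type*} (K : T → Set Y) (f : T → ℝ) (m : ℕ) (v v' : T)
    (h : (𝒯.cellGraph K).edist v v' ≤ m) : ENNReal.ofReal ((f v - f v') ^ 2)
      ≤ 4 ^ m * ∑' a : {a // (𝒯.cellGraph K).edist v a ≤ m}, 𝒯.gradSq K f a := by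
  induction m generalizing v with
  | zero => simp [𝒯.eq_of_edist_le_zero K h]
  | succ m ih =>
    obtain ⟨c, hc, hcv⟩ := 𝒯.exists_step_of_edist_le K h
    set S := ∑' a : {a // (𝒯.cellGraph K).edist v a ≤ (m + 1 : ℕ)}, 𝒯.gradSq K f a with hS
    have hself : 𝒯.gradSq K f v ≤ S :=
      ENNReal.le_tsum (f := fun a : {a // (𝒯.cellGraph K).edist v a ≤ (m + 1 : ℕ)} =>
        𝒯.gradSq K f a) ⟨v, by simp⟩
    have hstep : ENNReal.ofReal ((f v - f c) ^ 2) ≤ S := by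
      rcases hc with rfl | hc
      · simp
      · exact (ENNReal.le_tsum (f := fun b : {b // (𝒯.cellGraph K).Adj v b} =>
          ENNReal.ofReal ((f v - f b) ^ 2)) ⟨c, hc⟩).trans hself
    have hrest : ∑' a : {a // (𝒯.cellGraph K).edist c a ≤ m}, 𝒯.gradSq K f a ≤ S := by
      refine ENNReal.tsum_mono_subtype (𝒯.gradSq K f)
        (s := {a | (𝒯.cellGraph K).edist c a ≤ m})
        (t := {a | (𝒯.cellGraph K).edist v a ≤ (m + 1 : ℕ)}) fun a ha => ?_
      have := 𝒯.edist_le_add K (m := 1) (by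
        exact_mod_cast 𝒯.edist_le_one_of_adj_or_eq K hc) ha
      rwa [add_comm] at this
    have h1 : (f v - f v') ^ 2 ≤ 2 * (f v - f c) ^ 2 + 2 * (f c - f v') ^ 2 := by
      have := add_sq_le (a := f v - f c) (b := f c - f v')
      rw [sub_add_sub_cancel] at this
      linarith
    calc ENNReal.ofReal ((f v - f v') ^ 2)
        ≤ ENNReal.ofReal (2 * (f v - f c) ^ 2 + 2 * (f c - f v') ^ 2) :=
          ENNReal.ofReal_le_ofReal h1
      _ = 2 * ENNReal.ofReal ((f v - f c) ^ 2) + 2 * ENNReal.ofReal ((f c - f v') ^ 2) := by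
          rw [ENNReal.ofReal_add (by positivity) (by positivity),
            ENNReal.ofReal_mul (by norm_num), ENNReal.ofReal_mul (by norm_num)]
          simp
      _ ≤ 2 * S + 2 * (4 ^ m * S) := by
          gcongr
          exact (ih c hcv).trans (by gcongr)
      _ ≤ 2 * (4 ^ m * S) + 2 * (4 ^ m * S) := by
          gcongr
          calc S = 1 * S := (one_mul S).symm
            _ ≤ 4 ^ m * S := by
              gcongr
              exact one_le_pow₀ (by norm_num)
      _ = 4 ^ (m + 1) * S := by ring

/-- Differences over pairs of cells at bounded distance are controlled by the discrete energy. -/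
theorem exists_sum_near_le {Y : Type*} (K : T → Set Y)
    (h : ∃ L : ℕ, ∀ w, {v | (𝒯.cellGraph K).Adj w v}.encard ≤ L) (m : ℕ) :
    ∃ N : ℕ, ∀ (n : ℤ) (f : T → ℝ) (U : Finset T) (near : T → Finset T),
      (∀ v ∈ U, 𝒯.level v = n) → (∀ v, ∀ v' ∈ near v, (𝒯.cellGraph K).edist v v' ≤ m) →
      ENNReal.ofReal (∑ v ∈ U, ∑ v' ∈ near v, (f v - f v') ^ 2)
        ≤ N * 𝒯.discreteEnergy K n f := by
  classical
  obtain ⟨N, hN⟩ := 𝒯.exists_finset_ball K h m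
  choose s hs hmem using hN
  refine ⟨N * 4 ^ m * N * 2, fun n f U near hU hnear => ?_⟩
  have hball : ∀ v, ∑' a : {a // (𝒯.cellGraph K).edist v a ≤ m}, 𝒯.gradSq K f a
      = ∑' a, if (𝒯.cellGraph K).edist v a ≤ m then 𝒯.gradSq K f a else 0 := by
    intro v
    have := tsum_subtype {a | (𝒯.cellGraph K).edist v a ≤ m} (𝒯.gradSq K f)
    refine this.trans (tsum_congr fun a => ?_)
    rw [Set.indicator_apply]
    rfl
  have hlev : ∑' a : {a // 𝒯.level a = n}, 𝒯.gradSq K f a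
      = ∑' a, if 𝒯.level a = n then 𝒯.gradSq K f a else 0 := by
    have := tsum_subtype {a | 𝒯.level a = n} (𝒯.gradSq K f)
    refine this.trans (tsum_congr fun a => ?_)
    rw [Set.indicator_apply]
    rfl
  have hnearcard : ∀ v, (near v).card ≤ N := fun v =>
    (Finset.card_le_card fun v' hv' => hmem v v' (hnear v v' hv')).trans (hs v)
  -- After exchanging the sums, each gradient is counted at most `N` times, because balls of radius
  -- `m` in the cell graph have at most `N` elements.
  have hswap : ∑ v ∈ U, ∑' a : {a // (𝒯.cellGraph K).edist v a ≤ m}, 𝒯.gradSq K f a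
      ≤ N * (2 * 𝒯.discreteEnergy K n f) := by
    rw [← 𝒯.tsum_gradSq, hlev, ← ENNReal.tsum_mul_left]
    simp only [hball]
    rw [← Summable.tsum_finsetSum fun _ _ => ENNReal.summable]
    refine ENNReal.tsum_le_tsum fun a => ?_
    rw [← Finset.sum_filter, Finset.sum_const, nsmul_eq_mul]
    rcases (U.filter fun v => (𝒯.cellGraph K).edist v a ≤ m).eq_empty_or_nonempty with h0 | ⟨v, hv⟩
    · simp [h0]
    · obtain ⟨hvU, hva⟩ := Finset.mem_filter.1 hv
      rw [if_pos ((𝒯.level_eq_of_edist_le K hva).symm.trans (hU v hvU))]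
      gcongr
      refine (Finset.card_le_card fun v hv => ?_).trans (hs a)
      have := (Finset.mem_filter.1 hv).2
      rw [SimpleGraph.edist_comm] at this
      exact hmem a v this
  rw [ENNReal.ofReal_sum_of_nonneg fun _ _ => Finset.sum_nonneg fun _ _ => sq_nonneg _]
  calc ∑ v ∈ U, ENNReal.ofReal (∑ v' ∈ near v, (f v - f v') ^ 2)
      ≤ ∑ v ∈ U, N * (4 ^ m * ∑' a : {a // (𝒯.cellGraph K).edist v a ≤ m}, 𝒯.gradSq K f a) := by
        refine Finset.sum_le_sum fun v _ => ?_
        rw [ENNReal.ofReal_sum_of_nonneg fun _ _ => sq_nonneg _]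
        refine (Finset.sum_le_card_nsmul _ _ _ fun v' hv' =>
          𝒯.ofReal_sub_sq_le K f m v v' (hnear v v' hv')).trans ?_
        rw [nsmul_eq_mul]
        gcongr
        exact hnearcard v
    _ = N * (4 ^ m * ∑ v ∈ U, ∑' a : {a // (𝒯.cellGraph K).edist v a ≤ m}, 𝒯.gradSq K f a) := by
        simp only [Finset.mul_sum]
    _ ≤ N * (4 ^ m * (N * (2 * 𝒯.discreteEnergy K n f))) := by gcongr
    _ = _ := by push_cast; ring

end RefTree

/-! ### Local forms: interpolation and the lower bound. -/

theorem ResistanceForm.form_eq_zero_of_isLocal {X : Type*} {𝓔 : ResistanceForm X}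
    (hloc : 𝓔.IsLocal) {u v : 𝓔.dom} {δ : ℝ} (hδ : 0 < δ)
    (h : ∀ x y, 𝓔.ev u x ≠ 0 → 𝓔.ev v y ≠ 0 → δ ≤ dist x y) : 𝓔.form u v = 0 :=
  hloc u v ⟨δ, hδ, h⟩

namespace RefTree.IsBasicFramework

variable {X : Type*} {𝓔 : ResistanceForm X} {T : Type*} {𝒯 : RefTree T} {K : T → Set 𝓔.Space}
  {ζ : ℝ} {M : ℕ} (hK : 𝒯.IsBasicFramework K ζ M)
include hK

/-- For a local form, a finitely supported function on the cells of a level extends from the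
centers to a function in the domain with comparable energy. -/
theorem exists_interpolation (hloc : 𝓔.IsLocal) {ξ : ℝ} (hξ : 0 < ξ) {p : T → 𝓔.Space}
    (hsep : ∀ w v, 𝒯.level w = 𝒯.level v → w ≠ v → ∀ y ∈ K v,
      ξ * ζ ^ 𝒯.level w ≤ dist (p w) y) :
    ∃ C : ℝ, 0 < C ∧ ∀ (w : T) (f : T → ℝ), {v | 𝒯.level v = 𝒯.level w ∧ f v ≠ 0}.Finite →
      ∃ u : 𝓔.dom, (∀ v, 𝒯.level v = 𝒯.level w → 𝓔.ev u (p v) = f v) ∧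
        ENNReal.ofReal (𝓔.form u u * ζ ^ 𝒯.level w)
          ≤ ENNReal.ofReal C * 𝒯.discreteEnergy K (𝒯.level w) f := by
  classical
  obtain ⟨c, hc, hnear⟩ := hK.exists_edist_le
  set η := min ξ (c / 3) with hη
  have hη0 : 0 < η := lt_min hξ (by positivity)
  have hηξ : η ≤ ξ := min_le_left _ _
  have hηc : 3 * η ≤ c := by have := min_le_right ξ (c / 3); linarith
  obtain ⟨C₁, hC₁, φ, hφE, hφs, hφsum⟩ := hK.exists_partition_of_unity hnear hη0 (by linarith)
  obtain ⟨N₀, hN₀⟩ := 𝒯.exists_finset_ball K hK.bounded_degree (M + 2)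
  choose s hs hsmem using hN₀
  obtain ⟨N, hN⟩ := 𝒯.exists_sum_near_le K hK.bounded_degree (M + 2)
  refine ⟨C₁ / 2 * N + 1, by positivity, fun w f hfin => ?_⟩
  set n := 𝒯.level w with hn
  have hr : 0 < ζ ^ n := hK.zpow_pos n
  set near : T → Finset T := fun v =>
    (s v).filter fun i => (𝒯.cellGraph K).edist v i ≤ (M + 2 : ℕ) with hneardef
  have hmemnear : ∀ v i, (𝒯.cellGraph K).edist v i ≤ (M + 2 : ℕ) → i ∈ near v := fun v i h =>
    Finset.mem_filter.2 ⟨hsmem v i h, h⟩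
  -- The support of `f` together with its neighbors: near a cell of the support, the functions `φ
  -- v'` with `v' ∈ U` already add up to 1.
  set U : Finset T := hfin.toFinset ∪ hfin.toFinset.biUnion near with hUdef
  have hUl : ∀ v ∈ U, 𝒯.level v = n := by
    intro v hv
    rcases Finset.mem_union.1 hv with hv | hv
    · exact ((Set.Finite.mem_toFinset _).1 hv).1
    · obtain ⟨a, ha, hva⟩ := Finset.mem_biUnion.1 hv
      rw [← 𝒯.level_eq_of_edist_le K (Finset.mem_filter.1 hva).2]
      exact ((Set.Finite.mem_toFinset _).1 ha).1
  have hUf : ∀ v, 𝒯.level v = n → f v ≠ 0 → v ∈ U ∧ near v ⊆ U := by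
    intro v hv hfv
    have h1 : v ∈ hfin.toFinset := (Set.Finite.mem_toFinset _).2 ⟨hv, hfv⟩
    exact ⟨Finset.mem_union_left _ h1, fun i hi =>
      Finset.mem_union_right _ (Finset.mem_biUnion.2 ⟨v, h1, hi⟩)⟩
  have hsupp : ∀ v, 𝒯.level v = n → ∀ z, 𝓔.ev (φ v) z ≠ 0 → ∃ q ∈ K v, dist q z < η * ζ ^ n := by
    intro v hv z hz
    have := hφs v z hz
    rwa [hv] at this
  have hthree : ∀ v v', 𝒯.level v = n → 𝒯.level v' = n → ∀ q ∈ K v, ∀ q' ∈ K v', ∀ z z',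
      dist q z < η * ζ ^ n → dist z z' < η * ζ ^ n → dist q' z' < η * ζ ^ n → v' ∈ near v := by
    intro v v' hv hv' q hq q' hq' z z' h1 h2 h3
    refine hmemnear v v' (hnear v v' (hv.trans hv'.symm) q hq q' hq' ?_)
    rw [hv]
    have h4 := dist_triangle4 q z z' q'
    rw [dist_comm z' q'] at h4
    have h5 : 3 * η * ζ ^ n ≤ c * ζ ^ n := by gcongr
    linarith
  -- On the support of `f`, locality annihilates the pairing of `φ v` with `1 - ∑ φ v'`, and
  -- constants pair to 0. Off the support, where `U` may lack neighbors, the factor `f v ^ 2`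
  -- vanishes.
  have hrow : ∀ v ∈ U, f v ^ 2 * ∑ v' ∈ U, 𝓔.form (φ v) (φ v') = 0 := by
    intro v hv
    rcases eq_or_ne (f v) 0 with h0 | h0
    · rw [h0]; simp
    have hvl := hUl v hv
    have h1 : 𝓔.form (φ v) (𝓔.one - ∑ v' ∈ U, φ v') = 0 := by
      refine ResistanceForm.form_eq_zero_of_isLocal hloc (mul_pos hη0 hr) fun z z' hz hz' => ?_
      by_contra hlt
      have hlt' : dist z z' < η * ζ ^ n := not_le.1 hlt
      refine hz' ?_
      rw [𝓔.ev_sub, 𝓔.ev_sum, 𝓔.ev_one, sub_eq_zero]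
      symm
      refine hφsum w z' U hUl ?_
      rintro v' hv' ⟨q', hq', hqz'⟩
      obtain ⟨q, hq, hqz⟩ := hsupp v hvl z hz
      exact (hUf v hvl h0).2 (hthree v v' hvl hv' q hq q' hq' z z' hqz hlt' hqz')
    rw [map_sub, 𝓔.form_one_right, zero_sub, neg_eq_zero, map_sum] at h1
    rw [h1, mul_zero]
  have hfar : ∀ v ∈ U, ∀ v' ∈ U, v' ∉ near v → 𝓔.form (φ v) (φ v') = 0 := by
    intro v hv v' hv' hnot
    refine ResistanceForm.form_eq_zero_of_isLocal hloc (mul_pos hη0 hr) fun z z' hz hz' => ?_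
    by_contra hlt
    have hlt' : dist z z' < η * ζ ^ n := not_le.1 hlt
    obtain ⟨q, hq, hqz⟩ := hsupp v (hUl v hv) z hz
    obtain ⟨q', hq', hqz'⟩ := hsupp v' (hUl v' hv') z' hz'
    exact hnot (hthree v v' (hUl v hv) (hUl v' hv') q hq q' hq' z z' hqz hlt' hqz')
  have hcross : ∀ v ∈ U, ∀ v' ∈ U, |𝓔.form (φ v) (φ v')| ≤ C₁ / ζ ^ n := by
    intro v hv v' hv'
    have h1 := hφE v
    have h2 := hφE v'
    rw [hUl v hv] at h1
    rw [hUl v' hv'] at h2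
    have h3 : 0 ≤ C₁ / ζ ^ n := by positivity
    refine abs_le_of_sq_le_sq ((𝓔.form_sq_le _ _).trans ?_) h3
    rw [sq]
    exact mul_le_mul h1 h2 (𝓔.nonneg _) h3
  set u := ∑ v ∈ U, f v • φ v with hu
  have hval : ∀ v, 𝒯.level v = n → 𝓔.ev u (p v) = f v := by
    intro v hv
    have hone : ∀ v', 𝒯.level v' = n → (∃ q ∈ K v', dist q (p v) < η * ζ ^ n) → v' = v := by
      -- Because `η ≤ ξ`, no other cell of the level comes within `η * ζ ^ n` of `p v`, so `φ v`
      -- alone is nonzero there.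
      rintro v' hv' ⟨q, hq, hqv⟩
      by_contra hne
      have h1 := hsep v v' (hv.trans hv'.symm) (Ne.symm hne) q hq
      rw [dist_comm, hv] at h1
      have h2 : η * ζ ^ n ≤ ξ * ζ ^ n := by gcongr
      linarith
    have h1 : 𝓔.ev (φ v) (p v) = 1 := by
      have := hφsum w (p v) {v} (by simpa using hv) (by
        intro v' hv' hex
        simpa using hone v' hv' hex)
      simpa using this
    rw [hu, 𝓔.ev_sum, Finset.sum_eq_single v]
    · rw [𝓔.ev_smul, h1, mul_one]
    · intro v' hv' hne
      rw [𝓔.ev_smul]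
      by_cases h0 : 𝓔.ev (φ v') (p v) = 0
      · rw [h0, mul_zero]
      · exact absurd (hone v' (hUl v' hv') (hsupp v' (hUl v' hv') _ h0)) hne
    · intro hvU
      have : f v = 0 := by
        by_contra h
        exact hvU (hUf v hv h).1
      rw [this, 𝓔.ev_smul, zero_mul]
  refine ⟨u, hval, ?_⟩
  -- Zero row sums turn the quadratic form into `-1/2` times a sum of `𝓔(φ v, φ v') (f v - f v')²`;
  -- only nearby pairs survive, and their coefficients are bounded by Cauchy–Schwarz.
  have hE : 𝓔.form u u ≤ C₁ / ζ ^ n / 2 * ∑ v ∈ U, ∑ v' ∈ near v, (f v - f v') ^ 2 := by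
    have h1 := sum_sum_mul_sub_sq U (fun v v' => 𝓔.form (φ v) (φ v')) f (fun _ _ => 𝓔.symm _ _) hrow
    rw [← 𝓔.form_sum_smul, ← hu] at h1
    have h2 : -∑ v ∈ U, ∑ v' ∈ U, 𝓔.form (φ v) (φ v') * (f v - f v') ^ 2
        ≤ C₁ / ζ ^ n * ∑ v ∈ U, ∑ v' ∈ near v, (f v - f v') ^ 2 := by
      rw [← Finset.sum_neg_distrib, Finset.mul_sum]
      refine Finset.sum_le_sum fun v hv => ?_
      rw [← Finset.sum_neg_distrib, Finset.mul_sum]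
      calc ∑ v' ∈ U, -(𝓔.form (φ v) (φ v') * (f v - f v') ^ 2)
          ≤ ∑ v' ∈ U, if v' ∈ near v then C₁ / ζ ^ n * (f v - f v') ^ 2 else 0 := by
            refine Finset.sum_le_sum fun v' hv' => ?_
            split_ifs with h
            · rw [← neg_mul]
              exact mul_le_mul_of_nonneg_right ((neg_le_abs _).trans (hcross v hv v' hv'))
                (sq_nonneg _)
            · rw [hfar v hv v' hv' h]; simp
        _ = ∑ v' ∈ U with v' ∈ near v, C₁ / ζ ^ n * (f v - f v') ^ 2 :=
            (Finset.sum_filter _ _).symm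
        _ ≤ ∑ v' ∈ near v, C₁ / ζ ^ n * (f v - f v') ^ 2 := by
            refine Finset.sum_le_sum_of_subset_of_nonneg
              (fun v' hv' => (Finset.mem_filter.1 hv').2) fun _ _ _ => by positivity
    linarith
  have hfinal : 𝓔.form u u * ζ ^ n
      ≤ C₁ / 2 * ∑ v ∈ U, ∑ v' ∈ near v, (f v - f v') ^ 2 := by
    calc 𝓔.form u u * ζ ^ n
        ≤ C₁ / ζ ^ n / 2 * (∑ v ∈ U, ∑ v' ∈ near v, (f v - f v') ^ 2) * ζ ^ n := by gcongr
      _ = _ := by field_simp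
  refine (ENNReal.ofReal_le_ofReal hfinal).trans ?_
  rw [ENNReal.ofReal_mul (by positivity)]
  calc ENNReal.ofReal (C₁ / 2) * ENNReal.ofReal (∑ v ∈ U, ∑ v' ∈ near v, (f v - f v') ^ 2)
      ≤ ENNReal.ofReal (C₁ / 2) * (N * 𝒯.discreteEnergy K n f) := by
        gcongr
        exact hN n f U near hUl fun v v' hv' => (Finset.mem_filter.1 hv').2
    _ = ENNReal.ofReal (C₁ / 2 * N) * 𝒯.discreteEnergy K n f := by
        rw [ENNReal.ofReal_mul (by positivity), ENNReal.ofReal_natCast, mul_assoc]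
    _ ≤ _ := by
        gcongr
        linarith

/-- For a local form, some far cell is at a distance comparable to the size of the given cell. -/
theorem exists_far_point (hloc : 𝓔.IsLocal) : ∃ A : ℝ, 0 < A ∧ ∀ (w : T), ∀ x ∈ K w,
    (∃ v, 𝒯.level v = 𝒯.level w ∧ (M : ℕ∞) < (𝒯.cellGraph K).edist w v) →
      ∃ v, 𝒯.level v = 𝒯.level w ∧ (M : ℕ∞) < (𝒯.cellGraph K).edist w v ∧
        ∃ y ∈ K v, dist x y ≤ A * ζ ^ 𝒯.level w := by
  obtain ⟨C₁, hC₁, hdist⟩ := hK.exists_dist_le_of_edist_le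
  obtain ⟨C₂, hC₂, hcut⟩ := 𝓔.exists_cutoff hK.metricallyDoubling ((M + 1) * C₁) (by positivity)
  refine ⟨(M + 1) * C₁ + 1, by positivity, fun w x hx ⟨v₀, hv₀, hfar₀⟩ => ?_⟩
  by_contra hcon
  push Not at hcon
  have hr := hK.zpow_pos (𝒯.level w)
  -- Under the contrary assumption, `Q` is at distance at least `ζ ^ [w]` from its complement, so a
  -- cutoff `u` at `Q` is exactly its indicator. Locality gives `𝓔(u, 1 - u) = 0`, hence `𝓔(u, u) =
  -- 0` and `u` is constant, which is absurd.
  set Q : Set 𝓔.Space := {z | ∃ v, (𝒯.cellGraph K).edist w v ≤ M ∧ z ∈ K v} with hQ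
  have hQdist : ∀ q ∈ Q, dist x q ≤ (M + 1) * C₁ * ζ ^ 𝒯.level w := by
    rintro q ⟨v, hv, hqv⟩
    rw [mul_assoc]
    exact hdist M w v hv x hx q hqv
  have hfar : ∀ z ∉ Q, ∀ q ∈ Q, ζ ^ 𝒯.level w ≤ dist q z := by
    intro z hz q hq
    obtain ⟨v, hv, hzv⟩ := hK.exists_mem_level w z
    have h1 := hcon v hv (not_le.1 fun h => hz ⟨v, h, hzv⟩) z hzv
    have h2 := hQdist q hq
    have h3 := dist_triangle x q z
    linarith
  obtain ⟨u, -, hu1, hu0, -⟩ := hcut x (ζ ^ 𝒯.level w) Q hr hQdist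
  have hu0' : ∀ z ∉ Q, 𝓔.ev u z = 0 := fun z hz => hu0 z (hfar z hz)
  have h0 : 𝓔.form u (𝓔.one - u) = 0 := by
    refine ResistanceForm.form_eq_zero_of_isLocal hloc hr fun z z' hz hz' => ?_
    have hzQ : z ∈ Q := by
      by_contra h
      exact hz (hu0' z h)
    have hzQ' : z' ∉ Q := by
      intro h
      refine hz' ?_
      rw [𝓔.ev_sub, 𝓔.ev_one, hu1 z' h, sub_self]
    exact hfar z' hzQ' z hzQ
  rw [map_sub, 𝓔.form_one_right, zero_sub, neg_eq_zero] at h0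
  obtain ⟨a, ha⟩ := (𝓔.form_self_eq_zero_iff u).1 h0
  obtain ⟨y, hy⟩ := (hK.nontrivial v₀).nonempty
  have hyQ : y ∉ Q := by
    intro h
    have h1 := hQdist y h
    have h2 := hcon v₀ hv₀ hfar₀ y hy
    linarith
  have h1 : 𝓔.ev u x = 1 := hu1 x ⟨w, by simp, hx⟩
  have h2 : 𝓔.ev u y = 0 := hu0' y hyQ
  have h3 : 𝓔.ev u x = 𝓔.ev u y := (ha x).trans (ha y).symm
  rw [h1, h2] at h3
  exact one_ne_zero h3

/-- The interpolation of a competitor is 1 at a center in `K w` and 0 at a center in a far cell, and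
these centers are at distance at most `B * ζ ^ [w]`. Its energy is thus at least `1 / (B * ζ ^
[w])`, while it is at most `C * ζ ^ (-([w] + k))` times the discrete energy. -/
theorem le_energy₂ (hloc : 𝓔.IsLocal) : ∃ c : ℝ, 0 < c ∧ ∀ (w : T) (k : ℕ),
    (𝒯.farCells K M w k).Nonempty → ENNReal.ofReal (c * ζ ^ k) ≤ 𝒯.energy₂ K M k w := by
  classical
  obtain ⟨ξ, hξ, p, hp, -, hsep⟩ := hK.exists_centers
  obtain ⟨C, hC, hint⟩ := hK.exists_interpolation hloc hξ hsep
  obtain ⟨A, hA, hfarpt⟩ := hK.exists_far_point hloc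
  obtain ⟨C₁, hC₁, hdiam⟩ := hK.exists_dist_le
  set B := 2 * C₁ + A with hB
  have hBpos : 0 < B := by positivity
  refine ⟨1 / (B * C), by positivity, fun w k ⟨v₁, hv₁⟩ => ?_⟩
  have hζ := hK.scale_pos
  have hr := hK.zpow_pos (𝒯.level w)
  obtain ⟨v₀, hv₀, hv₀far, y, hy, hxy⟩ := hfarpt w (p w) (hp w)
    ⟨𝒯.π^[k] v₁, 𝒯.level_iterate le_rfl k hv₁.1, hv₁.2⟩
  obtain ⟨v', hv', hyv'⟩ := hK.exists_mem_descendants hy k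
  obtain ⟨v, hv, hpv⟩ := hK.exists_mem_descendants (hp w) k
  have hlv' : 𝒯.level v' = 𝒯.level w + k := by rw [hv'.2, hv₀]
  have hlv := hv.2
  have hv'far : v' ∈ 𝒯.farCells K M w k := ⟨hlv', by rw [hv'.1]; exact hv₀far⟩
  have hsmall : ζ ^ (𝒯.level w + k) ≤ ζ ^ 𝒯.level w :=
    zpow_le_zpow_right_of_le_one₀ hζ hK.scale_lt_one.le (by omega)
  have hdist : dist (p v) (p v') ≤ B * ζ ^ 𝒯.level w := by
    have h1 := hdiam v _ (hp v) _ hpv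
    have h2 := hdiam v' _ hyv' _ (hp v')
    rw [hlv] at h1
    rw [hlv'] at h2
    have h3 := dist_triangle4 (p v) (p w) y (p v')
    have h4 : C₁ * ζ ^ (𝒯.level w + k) ≤ C₁ * ζ ^ 𝒯.level w := by gcongr
    rw [hB]
    linarith
  rw [energy₂]
  refine le_iInf₂ fun f hf => ?_
  -- A competitor vanishes on the far cells, so its support consists of `k`-th generation
  -- descendants of the finitely many cells within `M` steps of `w`.
  have hfin : {a | 𝒯.level a = 𝒯.level v ∧ f a ≠ 0}.Finite := by
    obtain ⟨N₁, hN₁⟩ := 𝒯.exists_finset_ball K hK.bounded_degree M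
    obtain ⟨N₂, hN₂⟩ := 𝒯.exists_finset_descendants hK.bounded_branching k
    choose d _ hd using hN₂
    obtain ⟨s, -, hs⟩ := hN₁ w
    refine (s.biUnion d).finite_toSet.subset ?_
    rintro a ⟨hal, hfa⟩
    rw [hlv] at hal
    have h1 : (𝒯.cellGraph K).edist w (𝒯.π^[k] a) ≤ M := by
      by_contra h
      exact hfa (hf.2 a ⟨hal, not_le.1 h⟩)
    exact Finset.mem_coe.2 (Finset.mem_biUnion.2
      ⟨_, hs _ h1, hd _ a (𝒯.mem_descendants_iterate hal)⟩)
  obtain ⟨u, hu, huE⟩ := hint v f hfin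
  have h1 := 𝓔.ev_sub_sq_le u (p v) (p v')
  rw [hu v rfl, hu v' (hlv'.trans hlv.symm), hf.1 v hv, hf.2 v' hv'far] at h1
  have h2 : 1 ≤ B * ζ ^ 𝒯.level w * 𝓔.form u u := by
    have := mul_le_mul_of_nonneg_right hdist (𝓔.nonneg u)
    linarith
  rw [hlv] at huE
  have h3 : 1 / (B * C) * ζ ^ k ≤ 𝓔.form u u * ζ ^ (𝒯.level w + k) / C := by
    rw [zpow_add₀ hζ.ne', zpow_natCast]
    have h4 : 0 ≤ ζ ^ k / (B * C) := by positivity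
    calc 1 / (B * C) * ζ ^ k = ζ ^ k / (B * C) * 1 := by ring
      _ ≤ ζ ^ k / (B * C) * (B * ζ ^ 𝒯.level w * 𝓔.form u u) := by gcongr
      _ = _ := by field_simp
  refine (ENNReal.ofReal_le_ofReal h3).trans ?_
  rw [ENNReal.ofReal_div_of_pos hC]
  exact ENNReal.div_le_of_le_mul' huE

end RefTree.IsBasicFramework

theorem proposition3p10 {X : Type*} (𝓔 : ResistanceForm X) [CompleteSpace 𝓔.Space]
    {T : Type*} (𝒯 : RefTree T) (K : T → Set 𝓔.Space) (ζ : ℝ) (M : ℕ)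
    (hK : 𝒯.IsBasicFramework K ζ M) :
    (∃ C : ℝ, 0 < C ∧ ∀ (w : T) (k : ℕ), 𝒯.energy₂ K M k w ≤ ENNReal.ofReal (C * ζ ^ k)) ∧
    (𝓔.IsLocal → ∃ c : ℝ, 0 < c ∧ ∀ (w : T) (k : ℕ), (𝒯.farCells K M w k).Nonempty →
      ENNReal.ofReal (c * ζ ^ k) ≤ 𝒯.energy₂ K M k w) :=
  ⟨hK.exists_energy₂_le, hK.le_energy₂⟩
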